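/- Let $d\in\mathbb N$ and let $f:\mathbb R^d\to\mathbb R$ be three times continuously differentiable, with $\|\nabla f(x)\|\le L(1+\|x\|^a)$ for all $x$ and some $a,L>0$. Assume that $f$ has a unique minimizer $x^\ast$, that $f(x)\ge f(x^\ast)+\frac{\kappa}{2}\|x-x^\ast\|^\beta$ for all $x$, where $\kappa>0$ and $\beta\ge 1$, and that $f$ is $\lambda$-strongly convex on the open ball $B(x^\ast,\delta)$, where $\delta,\lambda>0$. For $\alpha,\gamma,R>0$ and a probability measure $\rho$ on $\mathbb R^d$ put $$\theta_\alpha(\rho)=\frac{\int x\,e^{-\alpha f(x)}\,d\rho(x)}{\int e^{-\alpha f(x)}\,d\rho(x)},\qquad \mathrm{clip}_R(x)=(R\wedge\|x\|)\frac{x}{\|x\|}\quad(\mathrm{clip}_R(0)=0),$$ and consider the McKean--Vlasov equation $$dX_t=\bigl(\mathrm{clip}_R(\theta_\alpha(\rho_t))-X_t\bigr)\,dt+\sqrt{\tfrac{2\gamma}{\alpha}}\,dB_t,\qquad \rho_t=\mathrm{Law}(X_t),\qquad X_0\sim\mathcal N(m_0,\sigma_0^2 I_d),\qquad (1)$$ where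 $B$ is a standard Brownian motion on $\mathbb R^d$ independent of $X_0$, $m_0\in\mathbb R^d$ and $\sigma_0\ge 0$. Put $$\gamma_0=\frac{8\,(R\vee\|m_0-x^\ast\|)}{\kappa\,\delta^{\beta-1}},\qquad C_0=6\gamma d,\qquad c_1=\Bigl(1+\frac{2}{\gamma\lambda}\Bigr)^{-1},\qquad T_{0,\alpha}=\frac12\log\Bigl(1+\bigl(1-\tfrac{2\alpha\sigma_0^2}{\gamma}\bigr)^+\Bigr).$$ Then for every $\gamma>0$ there is a constant $\alpha_0>0$, depending only on $\gamma$ and on $f$ (with the constants $\kappa,\beta,\delta,\lambda$), such that the following holds for all $R\ge\|x^\ast\|+\delta$, $m_0\in\mathbb R^d$ and $\sigma_0\ge 0$ with $\gamma>\gamma_0$, and for all $\alpha>\alpha_0$: every solution $(X_t)_{t\ge 0}$ of (1) has $\mathbb E\|X_t-x^\ast\|^2<\infty$ and $$\mathbb E\|X_t-x^\ast\|^2\le\frac{C_0}{\alpha}+9\,e^{-c_1(t-T_{0,\alpha})}\,\mathbb E\|X_0-x^\ast\|^2\qquad\text{for every }t>T_{0,\alpha}.$$ -/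

import Mathlib

open MeasureTheory ProbabilityTheory
open scoped NNReal

noncomputable section

/-- The clipping map `x ↦ (R ∧ ‖x‖) x / ‖x‖` (with value `0` at `0`). -/
def clip {d : ℕ} (R : ℝ) (x : EuclideanSpace ℝ (Fin d)) : EuclideanSpace ℝ (Fin d) :=
  (min R ‖x‖ / ‖x‖) • x

/-- The consensus point `θ_α(ρ) = ∫ x e^{-α f(x)} dρ(x) / ∫ e^{-α f(x)} dρ(x)`. -/
def consensusPoint {d : ℕ} (f : EuclideanSpace ℝ (Fin d) → ℝ) (α : ℝ)
    (ρ : Measure (EuclideanSpace ℝ (Fin d))) : EuclideanSpace ℝ (Fin d) :=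
  (∫ x, Real.exp (-α * f x) ∂ρ)⁻¹ • ∫ x, Real.exp (-α * f x) • x ∂ρ

/-- Standard Brownian motion on `ℝ^d`: the coordinates are independent real Brownian motions. -/
structure IsBrownianMotion {d : ℕ} {Ω : Type*} [MeasurableSpace Ω]
    (B : ℝ≥0 → Ω → EuclideanSpace ℝ (Fin d)) (P : Measure Ω) : Prop where
  measurable : ∀ t, Measurable (B t)
  brownian_coord : ∀ i : Fin d, IsBrownianReal (fun t ω ↦ B t ω i) P
  indep_coord : iIndepFun (fun (i : Fin d) ω (t : ℝ≥0) ↦ B t ω i) P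

/-- `X` solves `dX_t = (clip_R (θ_α(ρ_t)) - X_t) dt + √(2γ/α) dB_t`, where `ρ_t` is the law of
`X_t`, `B` is a Brownian motion on `ℝ^d`, and `X_0` has law `ν` and is independent of `B`.
Since the noise is additive, the equation is its integrated form along almost every path. -/
structure IsClippedSolution {d : ℕ} {Ω : Type*} [MeasurableSpace Ω] (P : Measure Ω)
    (f : EuclideanSpace ℝ (Fin d) → ℝ) (α γ R : ℝ) (ν : Measure (EuclideanSpace ℝ (Fin d)))
    (B X : ℝ≥0 → Ω → EuclideanSpace ℝ (Fin d)) : Prop where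
  brownian : IsBrownianMotion B P
  measurable : ∀ t, Measurable (X t)
  initial_law : HasLaw (X 0) ν P
  indep : IndepFun (X 0) (fun ω (t : ℝ≥0) ↦ B t ω) P
  continuous_paths : ∀ᵐ ω ∂P, Continuous fun t ↦ X t ω
  equation : ∀ᵐ ω ∂P, ∀ t : ℝ≥0,
    X t ω = X 0 ω
      + (∫ s in (0 : ℝ)..(t : ℝ),
          (clip R (consensusPoint f α (P.map (X s.toNNReal))) - X s.toNNReal ω))
      + √(2 * γ / α) • B t ω

/-- The time `T_{0,α} = ½ log (1 + (1 - 2 α σ₀² / γ)⁺)`. -/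
def initialTime (α γ σ₀ : ℝ) : ℝ :=
  1 / 2 * Real.log (1 + max (1 - 2 * α * σ₀ ^ 2 / γ) 0)

end

/-! ### Gibbs measures of the regularized potential: integrability, tails, integration by parts -/

section Gibbs

variable {E : Type*} [NormedAddCommGroup E] [InnerProductSpace ℝ E] [FiniteDimensional ℝ E]
  [MeasurableSpace E] [BorelSpace E]

/-! Idea of the whole proof. Apart from `-X`, the drift is a deterministic continuous function of
time, so variation of constants and the Gaussian initial law make every `X t` isotropic Gaussian.
Its variance `S t` is explicit and its mean solves `m' = clip θ - m` (`IsClippedSolution.map_eq`).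
For such a law the consensus point `θ` is the mean of the Gibbs measure with density proportional to
`exp (-α (f x + τ / 2 ‖x - m‖²))`, where `τ = 1 / (α S)`. What remains is an ODE for `m` and an
estimate of the Gibbs mean.

For large `α` that mean behaves like the proximal point of `m`. Integration by parts gives `E ∇f =
-τ (θ - m)`; the virial identity and strong convexity bound the variance by `O(1/α)`, hence by
Taylor `E ∇f = ∇f(θ) + O(1/α)`. Pairing with `θ - xs` yields `(lam + τ) ‖θ - xs‖ ≤ τ ‖m - xs‖ + C /
α` (`exists_gibbs_mean_contraction`). This requires concentration in the ball of strong convexity,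
which follows from a Laplace-type tail bound; for `τ ≤ 2 / γ` the growth of `f` and `γ > γ₀` ensure
its hypotheses. In the remaining cases the cruder bound `3 ‖m - xs‖ + C / α` is enough
(`exists_mean_bounds`).

The initial time is exactly when `S` has reached `γ / (2 α)`, i.e. `τ ≤ 2 / γ`. It is at most `½ log
2`, so up to then `‖m - xs‖²` grows by a factor of at most `8`, up to an `O(1/α²)` error; afterwards
it decays at rate `c₁`. The variance adds `d S t`, and for large `α` the squared error `O(1/α²)` is
below `5 γ d / α` when `d ≥ 1`. -/

lemma exists_one_add_rpow_le_exp (p : ℝ) {c : ℝ} (hc : 0 < c) :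
    ∃ A : ℝ, 0 ≤ A ∧ ∀ y : ℝ, 0 ≤ y → (1 + y) ^ p ≤ A * Real.exp (c * y) := by
  obtain ⟨N, hN⟩ := exists_nat_ge p
  refine ⟨N.factorial / c ^ N * Real.exp c, by positivity, fun y hy ↦ ?_⟩
  have h1 : (1 + y) ^ p ≤ (1 + y) ^ (N : ℝ) := Real.rpow_le_rpow_of_exponent_le (by linarith) hN
  have h2 := Real.pow_div_factorial_le_exp (c * (1 + y)) (by positivity) N
  rw [Real.rpow_natCast] at h1
  rw [div_le_iff₀ (by positivity), mul_pow] at h2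
  refine h1.trans ?_
  have h3 : Real.exp (c * (1 + y)) = Real.exp c * Real.exp (c * y) := by
    rw [← Real.exp_add]; ring_nf
  rw [h3] at h2
  rw [div_mul_eq_mul_div, div_mul_eq_mul_div, le_div_iff₀ (by positivity)]
  linarith

lemma integrable_exp_neg_mul_norm_sub {c : ℝ} (hc : 0 < c) (x₀ : E) :
    Integrable (fun x : E ↦ Real.exp (-(c * ‖x - x₀‖))) := by
  have key : Integrable (fun x : E ↦ Real.exp (-(c * ‖x‖))) := by
    set r : ℝ := Module.finrank ℝ E + 1
    obtain ⟨A, hA, hb⟩ := exists_one_add_rpow_le_exp r hc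
    refine ((integrable_one_add_norm (E := E) (μ := volume) (r := r) (by simp [r])).const_mul A).mono'
      (by fun_prop) (.of_forall fun x ↦ ?_)
    rw [Real.norm_of_nonneg (Real.exp_pos _).le, Real.rpow_neg (by positivity), Real.exp_neg,
      ← div_eq_mul_inv, le_div_iff₀ (by positivity), inv_mul_le_iff₀ (by positivity), mul_comm]
    exact hb _ (norm_nonneg _)
  exact key.comp_sub_right x₀

/-- The Gibbs measure with density proportional to `exp (-α (f x + τ / 2 ‖x - m‖²))`. -/
noncomputable def gibbs (f : E → ℝ) (α τ : ℝ) (m : E) : Measure E :=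
  volume.tilted (fun x ↦ -(α * (f x + τ / 2 * ‖x - m‖ ^ 2)))

variable {f : E → ℝ} {α τ : ℝ} {m xs : E}

lemma integrable_exp_mul_of_exp_growth {F : Type*} [NormedAddCommGroup F] [NormedSpace ℝ F]
    (hf : Continuous f) (hmin : ∀ x, f xs ≤ f x)
    (hα : 0 < α) (hτ : 0 < τ) {φ : E → F} (hφ : Continuous φ) {A c : ℝ}
    (hA : ∀ x, ‖φ x‖ ≤ A * Real.exp (c * ‖x - xs‖)) :
    Integrable (fun x ↦ Real.exp (-(α * (f x + τ / 2 * ‖x - m‖ ^ 2))) • φ x) := by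
  have hA0 : 0 ≤ A := by
    have := (norm_nonneg _).trans (hA xs)
    simpa using this
  set s := α * τ / 2
  have hs : 0 < s := by positivity
  -- By `(c + 1) r ≤ s r² + (c + 1)² / (4 s)`, the Gaussian factor pays for the growth rate `c` and
  -- for one further unit of exponential decay. The last summand accounts for moving the centre from
  -- `m` to `xs`.
  set K : ℝ := A * Real.exp (-(α * f xs) + (c + 1) ^ 2 / (4 * s) + |c + 1| * ‖m - xs‖)
  refine ((integrable_exp_neg_mul_norm_sub one_pos xs).const_mul K).mono'
    (by apply Continuous.aestronglyMeasurable; fun_prop) (.of_forall fun x ↦ ?_)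
  rw [norm_smul, Real.norm_of_nonneg (Real.exp_pos _).le]
  calc _ ≤ Real.exp (-(α * (f x + τ / 2 * ‖x - m‖ ^ 2))) * (A * Real.exp (c * ‖x - xs‖)) := by
        gcongr; exact hA x
    _ = A * Real.exp (-(α * (f x + τ / 2 * ‖x - m‖ ^ 2)) + c * ‖x - xs‖) := by
        rw [Real.exp_add]; ring
    _ ≤ A * Real.exp (-(α * f xs) + (c + 1) ^ 2 / (4 * s) + |c + 1| * ‖m - xs‖
          + -(1 * ‖x - xs‖)) := by
        refine mul_le_mul_of_nonneg_left (Real.exp_le_exp.2 ?_) hA0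
        have h1 : α * f xs ≤ α * f x := by gcongr; exact hmin x
        have h2 : (c + 1) * ‖x - xs‖ ≤ (c + 1) * ‖x - m‖ + |c + 1| * ‖m - xs‖ := by
          have ha : |‖x - xs‖ - ‖x - m‖| ≤ ‖m - xs‖ := by
            have := abs_norm_sub_norm_le (x - xs) (x - m)
            simpa using this
          have := abs_le.1 ((abs_mul (c + 1) (‖x - xs‖ - ‖x - m‖)).le.trans
            (mul_le_mul_of_nonneg_left ha (abs_nonneg _)))
          linarith
        have h3 : (c + 1) * ‖x - m‖ ≤ s * ‖x - m‖ ^ 2 + (c + 1) ^ 2 / (4 * s) := by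
          have : 0 ≤ (2 * s * ‖x - m‖ - (c + 1)) ^ 2 / (4 * s) := by positivity
          have e : (2 * s * ‖x - m‖ - (c + 1)) ^ 2 / (4 * s) =
            s * ‖x - m‖ ^ 2 - (c + 1) * ‖x - m‖ + (c + 1) ^ 2 / (4 * s) := by
            field_simp; ring
          linarith
        have e : α * (f x + τ / 2 * ‖x - m‖ ^ 2) = α * f x + s * ‖x - m‖ ^ 2 := by
          simp only [s]; ring
        rw [e]
        linarith
    _ = K * Real.exp (-(1 * ‖x - xs‖)) := by rw [Real.exp_add]; ring

lemma integrable_exp_potential (hf : Continuous f) (hmin : ∀ x, f xs ≤ f x)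
    (hα : 0 < α) (hτ : 0 < τ) :
    Integrable (fun x ↦ Real.exp (-(α * (f x + τ / 2 * ‖x - m‖ ^ 2)))) := by
  have := integrable_exp_mul_of_exp_growth (m := m) hf hmin hα hτ (φ := fun _ ↦ (1 : ℝ))
    continuous_const (A := 1) (c := 0) (by simp)
  simpa using this

lemma isProbabilityMeasure_gibbs (hf : Continuous f) (hmin : ∀ x, f xs ≤ f x)
    (hα : 0 < α) (hτ : 0 < τ) : IsProbabilityMeasure (gibbs f α τ m) :=
  isProbabilityMeasure_tilted (integrable_exp_potential hf hmin hα hτ)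

lemma integrable_gibbs {F : Type*} [NormedAddCommGroup F] [NormedSpace ℝ F]
    (hf : Continuous f) (hmin : ∀ x, f xs ≤ f x)
    (hα : 0 < α) (hτ : 0 < τ) {φ : E → F} (hφ : Continuous φ) {A c : ℝ}
    (hA : ∀ x, ‖φ x‖ ≤ A * Real.exp (c * ‖x - xs‖)) :
    Integrable φ (gibbs f α τ m) :=
  (integrable_tilted_iff (integrable_exp_potential hf hmin hα hτ) φ).2
    (integrable_exp_mul_of_exp_growth hf hmin hα hτ hφ hA)

/-- The Gibbs measure puts exponentially small mass where the potential grows linearly. -/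
lemma exists_tail_bound (f : E → ℝ) (xs : E) (hf : Continuous f) (hmin : ∀ x, f xs ≤ f x)
    {c₀ D ε : ℝ} (hc₀ : 0 < c₀) (hD : 0 < D) (hε : 0 < ε) :
    ∃ C : ℝ, 0 ≤ C ∧ ∀ (α τ G D' : ℝ) (m : E), 1 ≤ α → 0 < τ → D ≤ D' →
      (∀ x ∈ Metric.ball xs ε, f x + τ / 2 * ‖x - m‖ ^ 2 ≤ G + c₀ * D / 4) →
      (∀ x, D' ≤ ‖x - xs‖ → G + c₀ * ‖x - xs‖ ≤ f x + τ / 2 * ‖x - m‖ ^ 2) →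
      ∫ x, {x | D' ≤ ‖x - xs‖}.indicator (fun x ↦ Real.exp (c₀ / 4 * ‖x - xs‖)) x
        ∂(gibbs f α τ m) ≤ C / α := by
  set J : ℝ := ∫ x : E, Real.exp (-(c₀ / 4 * ‖x - xs‖))
  set V : ℝ := volume.real (Metric.ball xs ε)
  have hV : 0 < V := by
    have := Metric.measure_ball_pos (volume : Measure E) xs hε
    exact ENNReal.toReal_pos this.ne' measure_ball_lt_top.ne
  have hJ : 0 ≤ J := integral_nonneg fun x ↦ (Real.exp_pos _).le
  refine ⟨J / V * (4 / (c₀ * D)), by positivity, fun α τ G D' m hα hτ hD' H1 H2 ↦ ?_⟩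
  have hα0 : 0 < α := by linarith
  have hint := integrable_exp_potential (m := m) hf hmin hα0 hτ
  set Z : ℝ := ∫ x, Real.exp (-(α * (f x + τ / 2 * ‖x - m‖ ^ 2)))
  -- The partition function is bounded below on the small ball. The gap between `c₀ D / 4` here and
  -- `c₀ D / 2` on the tail makes the ratio small.
  have hZ : V * Real.exp (-(α * (G + c₀ * D / 4))) ≤ Z := by
    calc V * Real.exp (-(α * (G + c₀ * D / 4)))
        = ∫ x in Metric.ball xs ε, Real.exp (-(α * (G + c₀ * D / 4))) := by
          rw [setIntegral_const, smul_eq_mul]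
      _ ≤ ∫ x in Metric.ball xs ε, Real.exp (-(α * (f x + τ / 2 * ‖x - m‖ ^ 2))) := by
          refine setIntegral_mono_on (integrableOn_const (measure_ball_lt_top.ne)) hint.integrableOn
            measurableSet_ball fun x hx ↦ ?_
          exact Real.exp_le_exp.2 (neg_le_neg (mul_le_mul_of_nonneg_left (H1 x hx) hα0.le))
      _ ≤ Z := setIntegral_le_integral hint (.of_forall fun x ↦ (Real.exp_pos _).le)
  have hZ0 : 0 < Z := lt_of_lt_of_le (by positivity) hZ
  rw [gibbs, integral_tilted]
  have hpt : ∀ x, (Real.exp (-(α * (f x + τ / 2 * ‖x - m‖ ^ 2))) / Z) •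
      {x | D' ≤ ‖x - xs‖}.indicator (fun x ↦ Real.exp (c₀ / 4 * ‖x - xs‖)) x ≤
      Real.exp (-(α * (G + c₀ * D / 2))) / Z * Real.exp (-(c₀ / 4 * ‖x - xs‖)) := by
    intro x
    by_cases hx : D' ≤ ‖x - xs‖
    · rw [Set.indicator_of_mem (by exact hx), smul_eq_mul, div_mul_eq_mul_div,
        div_mul_eq_mul_div (Real.exp _) Z (Real.exp _), ← Real.exp_add, ← Real.exp_add]
      refine div_le_div_of_nonneg_right (Real.exp_le_exp.2 ?_) hZ0.le
      -- Half of `α c₀ r` gives the small factor, by `r ≥ D`. The other half is at least `c₀ r / 2`,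
      -- by `α ≥ 1`: it absorbs the weight `c₀ r / 4` and leaves `c₀ r / 4` for integrability.
      have h2 := mul_le_mul_of_nonneg_left (H2 x hx) hα0.le
      have h3 : α * (c₀ * D / 2) ≤ α * (c₀ * ‖x - xs‖ / 2) := by
        gcongr; exact hD'.trans hx
      have h4 : 1 * (c₀ * ‖x - xs‖ / 2) ≤ α * (c₀ * ‖x - xs‖ / 2) := by gcongr
      linarith
    · rw [Set.indicator_of_notMem (by exact hx), smul_zero]
      positivity
  calc _ ≤ ∫ x, Real.exp (-(α * (G + c₀ * D / 2))) / Z * Real.exp (-(c₀ / 4 * ‖x - xs‖)) := by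
        refine integral_mono_of_nonneg (.of_forall fun x ↦ ?_)
          ((integrable_exp_neg_mul_norm_sub (by positivity) xs).const_mul _) (.of_forall hpt)
        exact smul_nonneg (by positivity) (Set.indicator_nonneg (fun _ _ ↦ (Real.exp_pos _).le) _)
    _ = Real.exp (-(α * (G + c₀ * D / 2))) / Z * J := integral_const_mul _ _
    _ ≤ Real.exp (-(α * (G + c₀ * D / 2))) / (V * Real.exp (-(α * (G + c₀ * D / 4)))) * J := by
        gcongr
    _ = J / V * Real.exp (-(α * (c₀ * D / 4))) := by
        have : Real.exp (-(α * (G + c₀ * D / 2))) =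
          Real.exp (-(α * (c₀ * D / 4))) * Real.exp (-(α * (G + c₀ * D / 4))) := by
          rw [← Real.exp_add]; ring_nf
        rw [this]
        field_simp
    _ ≤ J / V * (4 / (c₀ * D) / α) := by
        gcongr
        have := Real.add_one_le_exp (α * (c₀ * D / 4))
        rw [Real.exp_neg, inv_le_comm₀ (Real.exp_pos _) (by positivity)]
        have e : (4 / (c₀ * D) / α)⁻¹ = α * (c₀ * D / 4) := by field_simp
        rw [e]; linarith
    _ = _ := by ring

/-- Integration by parts against the Gibbs measure. -/
lemma integral_gibbs_mul_fderiv (hf : ContDiff ℝ 1 f) (hmin : ∀ x, f xs ≤ f x)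
    (hα : 0 < α) (hτ : 0 < τ) {A c : ℝ} (hA : ∀ x, ‖fderiv ℝ f x‖ ≤ A * Real.exp (c * ‖x - xs‖))
    {h : E → ℝ} (hh : ContDiff ℝ 1 h) {A₁ c₁ : ℝ} (hh0 : ∀ x, ‖h x‖ ≤ A₁ * Real.exp (c₁ * ‖x - xs‖))
    (hh1 : ∀ x, ‖fderiv ℝ h x‖ ≤ A₁ * Real.exp (c₁ * ‖x - xs‖)) (v : E) :
    ∫ x, h x * (fderiv ℝ f x v + τ * inner ℝ (x - m) v) ∂(gibbs f α τ m)
      = α⁻¹ * ∫ x, fderiv ℝ h x v ∂(gibbs f α τ m) := by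
  have hint := integrable_exp_potential (m := m) hf.continuous hmin hα hτ
  set w : E → ℝ := fun x ↦ Real.exp (-(α * (f x + τ / 2 * ‖x - m‖ ^ 2)))
  have hw : ContDiff ℝ 1 w := by
    simp only [w]
    have : ContDiff ℝ 1 fun x : E ↦ ‖x - m‖ ^ 2 := (contDiff_id.sub contDiff_const).norm_sq ℝ
    fun_prop
  have hw' : ∀ x, fderiv ℝ w x v = -α * (w x * (fderiv ℝ f x v + τ * inner ℝ (x - m) v)) := by
    intro x
    have h1 : HasFDerivAt f (fderiv ℝ f x) x := (hf.differentiable one_ne_zero x).hasFDerivAt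
    have h2 : HasFDerivAt (fun y : E ↦ ‖y - m‖ ^ 2) _ x :=
      ((hasFDerivAt_id x).sub_const m).norm_sq
    have h3 := (((h1.add (h2.const_mul (τ / 2))).const_mul α).neg).exp
    have h4 : HasFDerivAt w _ x := h3
    rw [h4.fderiv]
    simp [w, inner_sub_left (𝕜 := ℝ) x m v]
    ring
  have hcf : Continuous (fun x ↦ fderiv ℝ f x v) :=
    (hf.continuous_fderiv one_ne_zero).clm_apply continuous_const
  have hch : Continuous (fun x ↦ fderiv ℝ h x v) :=
    (hh.continuous_fderiv one_ne_zero).clm_apply continuous_const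
  have hA0 : 0 ≤ A := by simpa using (norm_nonneg _).trans (hA xs)
  have hA1 : 0 ≤ A₁ := by simpa using (norm_nonneg _).trans (hh0 xs)
  have i1 : Integrable (fun x ↦ fderiv ℝ h x v * w x) := by
    have := integrable_exp_mul_of_exp_growth (m := m) hf.continuous hmin hα hτ hch (A := A₁ * ‖v‖)
      (c := c₁) (fun x ↦ ?_)
    · simpa [w, mul_comm] using this
    · calc _ ≤ ‖fderiv ℝ h x‖ * ‖v‖ := ContinuousLinearMap.le_opNorm _ _
        _ ≤ A₁ * Real.exp (c₁ * ‖x - xs‖) * ‖v‖ := by gcongr; exact hh1 x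
        _ = _ := by ring
  have i2 : Integrable (fun x ↦ h x * w x) := by
    have := integrable_exp_mul_of_exp_growth (m := m) hf.continuous hmin hα hτ hh.continuous hh0
    simpa [w, mul_comm] using this
  have hlin : ∀ x, ‖x - m‖ ≤ (1 + ‖xs - m‖) * Real.exp (1 * ‖x - xs‖) := by
    intro x
    have h1 : ‖x - m‖ ≤ ‖x - xs‖ + ‖xs - m‖ := by
      simpa using norm_add_le (x - xs) (xs - m)
    have h2 := Real.add_one_le_exp (1 * ‖x - xs‖)
    nlinarith [norm_nonneg (x - xs), norm_nonneg (xs - m)]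
  have i3 : Integrable (fun x ↦ h x * fderiv ℝ w x v) := by
    have hcont : Continuous fun x ↦ h x * (fderiv ℝ f x v + τ * inner ℝ (x - m) v) := by
      have := hh.continuous
      fun_prop
    have := integrable_exp_mul_of_exp_growth (m := m) hf.continuous hmin hα hτ hcont
      (A := A₁ * ((A + τ * (1 + ‖xs - m‖)) * ‖v‖)) (c := c₁ + max c 1) (fun x ↦ ?_)
    · refine (this.const_mul (-α)).congr (.of_forall fun x ↦ ?_)
      simp only [hw', smul_eq_mul, w]; ring
    · have e1 : A * Real.exp (c * ‖x - xs‖) ≤ A * Real.exp (max c 1 * ‖x - xs‖) := by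
        gcongr; exact le_max_left _ _
      have e2 : (1 + ‖xs - m‖) * Real.exp (1 * ‖x - xs‖) ≤
          (1 + ‖xs - m‖) * Real.exp (max c 1 * ‖x - xs‖) := by
        gcongr; exact le_max_right _ _
      have e3 : ‖fderiv ℝ f x v + τ * inner ℝ (x - m) v‖ ≤
          (A + τ * (1 + ‖xs - m‖)) * Real.exp (max c 1 * ‖x - xs‖) * ‖v‖ := by
        calc _ ≤ ‖fderiv ℝ f x v‖ + ‖τ * inner ℝ (x - m) v‖ := norm_add_le _ _
          _ ≤ ‖fderiv ℝ f x‖ * ‖v‖ + τ * (‖x - m‖ * ‖v‖) := by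
            rw [norm_mul, Real.norm_of_nonneg hτ.le]
            gcongr
            · exact ContinuousLinearMap.le_opNorm _ _
            · exact norm_inner_le_norm _ _
          _ ≤ (A * Real.exp (max c 1 * ‖x - xs‖)) * ‖v‖ +
              τ * (((1 + ‖xs - m‖) * Real.exp (max c 1 * ‖x - xs‖)) * ‖v‖) := by
            gcongr
            · exact (hA x).trans e1
            · exact (hlin x).trans e2
          _ = _ := by ring
      calc _ = ‖h x‖ * ‖fderiv ℝ f x v + τ * inner ℝ (x - m) v‖ := norm_mul _ _
        _ ≤ (A₁ * Real.exp (c₁ * ‖x - xs‖)) *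
            ((A + τ * (1 + ‖xs - m‖)) * Real.exp (max c 1 * ‖x - xs‖) * ‖v‖) := by
          gcongr
          exact hh0 x
        _ = _ := by rw [add_mul c₁, Real.exp_add]; ring
  have ibp := integral_mul_fderiv_eq_neg_fderiv_mul_of_integrable i1 i3 i2
    (fun x _ ↦ hh.differentiable one_ne_zero x) (fun x _ ↦ hw.differentiable one_ne_zero x)
  rw [gibbs, integral_tilted, integral_tilted]
  have e1 : ∀ x, (Real.exp (-(α * (f x + τ / 2 * ‖x - m‖ ^ 2))) /
      ∫ x, Real.exp (-(α * (f x + τ / 2 * ‖x - m‖ ^ 2)))) •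
      (h x * (fderiv ℝ f x v + τ * inner ℝ (x - m) v)) =
      -(α⁻¹ * (∫ x, w x)⁻¹) * (h x * fderiv ℝ w x v) := by
    intro x
    rw [hw']
    simp only [smul_eq_mul, w]
    field_simp
  have e2 : ∀ x, (Real.exp (-(α * (f x + τ / 2 * ‖x - m‖ ^ 2))) /
      ∫ x, Real.exp (-(α * (f x + τ / 2 * ‖x - m‖ ^ 2)))) • fderiv ℝ h x v =
      (∫ x, w x)⁻¹ * (fderiv ℝ h x v * w x) := by
    intro x
    simp only [smul_eq_mul, w]
    ring
  simp_rw [e1, e2]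
  rw [integral_const_mul, integral_const_mul, ibp]
  ring

end Gibbs

/-! ### Strong convexity and Taylor expansion -/

section Local

variable {E : Type*} [NormedAddCommGroup E] [InnerProductSpace ℝ E]

/-- Divide the strong convexity inequality at `x + t • (y - x)` by `t` and let `t` decrease to `0`.
-/
lemma StrongConvexOn.add_fderiv_le {s : Set E} {f : E → ℝ} {lam : ℝ} (h : StrongConvexOn s lam f)
    {x y : E} (hx : x ∈ s) (hy : y ∈ s) (hd : DifferentiableAt ℝ f x) :
    f x + fderiv ℝ f x (y - x) + lam / 2 * ‖x - y‖ ^ 2 ≤ f y := by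
  have hder : HasDerivAt (fun t : ℝ ↦ f (x + t • (y - x))) (fderiv ℝ f x (y - x)) 0 := by
    have h1 : HasDerivAt (fun t : ℝ ↦ x + t • (y - x)) (y - x) 0 := by
      simpa using ((hasDerivAt_id (0 : ℝ)).smul_const (y - x)).const_add x
    have h2 : HasFDerivAt f (fderiv ℝ f x) (x + (0 : ℝ) • (y - x)) := by
      simpa using hd.hasFDerivAt
    exact h2.comp_hasDerivAt 0 h1
  have hslope := hder.tendsto_slope_zero_right
  have hlim : Filter.Tendsto (fun t : ℝ ↦ f y - f x - (1 - t) * (lam / 2 * ‖x - y‖ ^ 2))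
      (nhdsWithin 0 (Set.Ioi 0)) (nhds (f y - f x - (1 - 0) * (lam / 2 * ‖x - y‖ ^ 2))) := by
    refine Filter.Tendsto.mono_left (Continuous.tendsto ?_ 0) nhdsWithin_le_nhds
    fun_prop
  have hle := le_of_tendsto_of_tendsto hslope hlim (by
    have : Set.Ioo (0 : ℝ) 1 ∈ nhdsWithin (0 : ℝ) (Set.Ioi 0) := Ioo_mem_nhdsGT one_pos
    filter_upwards [this] with t ht
    have hu : UniformConvexOn s (fun r ↦ lam / 2 * r ^ 2) f := h
    have hc := hu.2 hx hy (show (0 : ℝ) ≤ 1 - t by linarith [ht.2]) ht.1.le (by ring)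
    have e : (1 - t) • x + t • y = x + t • (y - x) := by module
    rw [e] at hc
    simp only [smul_eq_mul, zero_add, zero_smul, add_zero] at hc ⊢
    rw [inv_mul_le_iff₀ ht.1]
    nlinarith)
  linarith

lemma StrongConvexOn.le_fderiv_sub_fderiv {s : Set E} {f : E → ℝ} {lam : ℝ}
    (h : StrongConvexOn s lam f) (hd : Differentiable ℝ f) {x y : E} (hx : x ∈ s) (hy : y ∈ s) :
    lam * ‖x - y‖ ^ 2 ≤ fderiv ℝ f x (x - y) - fderiv ℝ f y (x - y) := by
  have h1 := h.add_fderiv_le hx hy (hd x)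
  have h2 := h.add_fderiv_le hy hx (hd y)
  rw [← neg_sub x y, map_neg] at h1
  rw [norm_sub_rev y x] at h2
  linarith

/-- To be applied to `g = fderiv ℝ f`, which is where three derivatives of `f` are used. The
constant must be uniform in the base point `y`, since the expansion is made at the Gibbs mean, which
moves with the parameters. -/
lemma ContDiff.exists_norm_sub_sub_fderiv_le {F : Type*} [NormedAddCommGroup F] [NormedSpace ℝ F]
    [FiniteDimensional ℝ E] {g : E → F} (hg : ContDiff ℝ 2 g) (x₀ : E) (r : ℝ) :
    ∃ C : ℝ, 0 ≤ C ∧ ∀ x ∈ Metric.closedBall x₀ r, ∀ y ∈ Metric.closedBall x₀ r,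
      ‖g x - g y - fderiv ℝ g y (x - y)‖ ≤ C * ‖x - y‖ ^ 2 := by
  have hg1 : ContDiff ℝ 1 (fderiv ℝ g) := hg.fderiv_right (by norm_num)
  have hcpt : IsCompact (Metric.closedBall x₀ r) := isCompact_closedBall x₀ r
  obtain ⟨K, hK⟩ := hcpt.exists_bound_of_continuousOn
    (hg1.continuous_fderiv one_ne_zero).continuousOn
  refine ⟨max K 0, le_max_right _ _, fun x hx y hy ↦ ?_⟩
  have hseg : segment ℝ y x ⊆ Metric.closedBall x₀ r :=
    (convex_closedBall x₀ r).segment_subset hy hx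
  have hlip : ∀ z ∈ segment ℝ y x, ‖fderiv ℝ g z - fderiv ℝ g y‖ ≤ max K 0 * ‖x - y‖ := by
    intro z hz
    have h1 := (convex_closedBall x₀ r).norm_image_sub_le_of_norm_fderiv_le (𝕜 := ℝ)
      (f := fderiv ℝ g) (C := max K 0)
      (fun w _ ↦ hg1.differentiable one_ne_zero w) (fun w hw ↦ (hK w hw).trans (le_max_left _ _))
      hy (hseg hz)
    refine h1.trans (mul_le_mul_of_nonneg_left ?_ (le_max_right _ _))
    exact norm_sub_le_of_mem_segment hz
  have h2 := (convex_segment y x).norm_image_sub_le_of_norm_fderiv_le' (𝕜 := ℝ)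
    (f := g) (φ := fderiv ℝ g y)
    (fun w _ ↦ hg.differentiable two_ne_zero w) hlip (left_mem_segment ℝ y x)
    (right_mem_segment ℝ y x)
  exact h2.trans_eq (by ring)

lemma sum_inner_mul_apply {n : ℕ} (b : OrthonormalBasis (Fin n) ℝ E) (L : E →L[ℝ] ℝ)
    (y : E) : ∑ i, inner ℝ y (b i) * L (b i) = L y := by
  conv_rhs => rw [← b.sum_repr y, map_sum]
  refine Finset.sum_congr rfl fun i _ ↦ ?_
  rw [map_smul, smul_eq_mul, b.repr_apply_apply, real_inner_comm]

end Local

lemma norm_sub_le_mul_exp {E : Type*} [NormedAddCommGroup E] (y xs x : E) :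
    ‖x - y‖ ≤ (1 + ‖xs - y‖) * Real.exp (1 * ‖x - xs‖) := by
  have h1 : ‖x - y‖ ≤ ‖x - xs‖ + ‖xs - y‖ := by simpa using norm_add_le (x - xs) (xs - y)
  have h2 := Real.add_one_le_exp (1 * ‖x - xs‖)
  nlinarith [norm_nonneg (x - xs), norm_nonneg (xs - y)]

/-! ### First-order condition and virial identity -/

section GibbsMean

variable {E : Type*} [NormedAddCommGroup E] [InnerProductSpace ℝ E] [FiniteDimensional ℝ E]
  [MeasurableSpace E] [BorelSpace E]
variable {f : E → ℝ} {α τ : ℝ} {m xs : E}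

lemma integrable_id_gibbs (hf : Continuous f) (hmin : ∀ x, f xs ≤ f x) (hα : 0 < α) (hτ : 0 < τ) :
    Integrable (fun x ↦ x) (gibbs f α τ m) := by
  refine integrable_gibbs hf hmin hα hτ continuous_id (A := 1 + ‖xs‖) (c := 1) fun x ↦ ?_
  have h1 : ‖x‖ ≤ ‖x - xs‖ + ‖xs‖ := by simpa using norm_add_le (x - xs) xs
  have h2 := Real.add_one_le_exp (1 * ‖x - xs‖)
  nlinarith [norm_nonneg (x - xs), norm_nonneg xs]

/-- The first-order condition for the mean of the Gibbs measure. -/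
lemma integral_fderiv_gibbs (hf : ContDiff ℝ 1 f) (hmin : ∀ x, f xs ≤ f x)
    (hα : 0 < α) (hτ : 0 < τ) {A c : ℝ} (hA : ∀ x, ‖fderiv ℝ f x‖ ≤ A * Real.exp (c * ‖x - xs‖))
    (v : E) :
    ∫ x, fderiv ℝ f x v ∂(gibbs f α τ m)
      = - (τ * inner ℝ (∫ x, x ∂(gibbs f α τ m) - m) v) := by
  have := isProbabilityMeasure_gibbs (m := m) hf.continuous hmin hα hτ
  have h := integral_gibbs_mul_fderiv (m := m) hf hmin hα hτ hA (h := fun _ ↦ (1 : ℝ))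
    contDiff_const (A₁ := 1) (c₁ := 0) (by simp) (by simp) v
  have hid := integrable_id_gibbs (m := m) hf.continuous hmin hα hτ
  have hi : Integrable (fun x ↦ fderiv ℝ f x v) (gibbs f α τ m) := by
    refine integrable_gibbs hf.continuous hmin hα hτ (A := A * ‖v‖) (c := c)
      ((hf.continuous_fderiv one_ne_zero).clm_apply continuous_const) fun x ↦ ?_
    calc _ ≤ ‖fderiv ℝ f x‖ * ‖v‖ := ContinuousLinearMap.le_opNorm _ _
      _ ≤ A * Real.exp (c * ‖x - xs‖) * ‖v‖ := by gcongr; exact hA x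
      _ = _ := by ring
  have hi2 : Integrable (fun x ↦ τ * inner ℝ (x - m) v) (gibbs f α τ m) :=
    ((hid.sub (integrable_const m)).inner_const v).const_mul τ
  simp only [one_mul, fderiv_fun_const, Pi.zero_apply, zero_apply,
    integral_zero, mul_zero] at h
  rw [integral_add hi hi2, integral_const_mul] at h
  have e : ∫ x, inner ℝ (x - m) v ∂(gibbs f α τ m)
      = inner ℝ (∫ x, x ∂(gibbs f α τ m) - m) v := by
    have h1 := integral_inner (𝕜 := ℝ) (hid.sub (integrable_const m)) v
    simp only [Pi.sub_apply] at h1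
    rw [integral_sub hid (integrable_const m)] at h1
    simp only [integral_const, probReal_univ, one_smul] at h1
    rw [real_inner_comm, ← h1]
    simp_rw [real_inner_comm v]
  rw [e] at h
  linarith

/-- The virial identity for the Gibbs measure. -/
lemma integral_fderiv_sub_mean_gibbs (hf : ContDiff ℝ 1 f) (hmin : ∀ x, f xs ≤ f x)
    (hα : 0 < α) (hτ : 0 < τ) {A c : ℝ} (hA : ∀ x, ‖fderiv ℝ f x‖ ≤ A * Real.exp (c * ‖x - xs‖))
    {θ : E} (hθ : θ = ∫ x, x ∂(gibbs f α τ m)) :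
    ∫ x, fderiv ℝ f x (x - θ) ∂(gibbs f α τ m) + τ * ∫ x, ‖x - θ‖ ^ 2 ∂(gibbs f α τ m)
      = Module.finrank ℝ E / α := by
  have := isProbabilityMeasure_gibbs (m := m) hf.continuous hmin hα hτ
  have hid := integrable_id_gibbs (m := m) hf.continuous hmin hα hτ
  have hA0 : 0 ≤ A := by simpa using (norm_nonneg _).trans (hA xs)
  set b := stdOrthonormalBasis ℝ E
  have hlin (i) : fderiv ℝ (fun x : E ↦ inner ℝ (x - θ) (b i)) = fun _ ↦ innerSL ℝ (b i) := by
    ext x v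
    have h1 : HasFDerivAt (fun x : E ↦ inner ℝ (b i) (x - θ)) (innerSL ℝ (b i)) x :=
      (innerSL ℝ (b i)).hasFDerivAt.comp x ((hasFDerivAt_id x).sub_const θ)
    simp_rw [real_inner_comm _ (b i)] at h1
    rw [h1.fderiv]
  -- Integration by parts against a centred coordinate: each direction of the basis contributes
  -- `α⁻¹`, which sums to `finrank / α`.
  have key (i) : ∫ x, inner ℝ (x - θ) (b i) * (fderiv ℝ f x (b i) + τ * inner ℝ (x - m) (b i))
      ∂(gibbs f α τ m) = α⁻¹ := by
    rw [integral_gibbs_mul_fderiv hf hmin hα hτ hA (h := fun x ↦ inner ℝ (x - θ) (b i))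
      (A₁ := 1 + ‖xs - θ‖) (c₁ := 1)
      ((contDiff_id.sub contDiff_const).inner ℝ contDiff_const) (fun x ↦ ?_) (fun x ↦ ?_), hlin]
    · simp
    · refine (norm_inner_le_norm _ _).trans ?_
      simpa using norm_sub_le_mul_exp θ xs x
    · rw [hlin, innerSL_apply_norm, b.norm_eq_one]
      have := Real.one_le_exp (x := 1 * ‖x - xs‖) (by positivity)
      nlinarith [norm_nonneg (xs - θ)]
  have hgi (i) : Integrable (fun x ↦ inner ℝ (x - θ) (b i) *
      (fderiv ℝ f x (b i) + τ * inner ℝ (x - m) (b i))) (gibbs f α τ m) := by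
    refine Integrable.of_integral_ne_zero ?_
    rw [key]; positivity
  have hsum : ∑ i, ∫ x, inner ℝ (x - θ) (b i) *
      (fderiv ℝ f x (b i) + τ * inner ℝ (x - m) (b i)) ∂(gibbs f α τ m)
        = Module.finrank ℝ E / α := by
    simp_rw [key]
    simp [div_eq_mul_inv]
  rw [← integral_finsetSum _ fun i _ ↦ hgi i] at hsum
  have hpt (x : E) : ∑ i, inner ℝ (x - θ) (b i) * (fderiv ℝ f x (b i) + τ * inner ℝ (x - m) (b i))
      = fderiv ℝ f x (x - θ) + τ * ‖x - θ‖ ^ 2 + τ * inner ℝ (θ - m) (x - θ) := by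
    have h := sum_inner_mul_apply b (fderiv ℝ f x + τ • innerSL ℝ (x - m)) (x - θ)
    simp only [add_apply, smul_apply, innerSL_apply_apply,
      smul_eq_mul] at h
    rw [h]
    have : x - m = (x - θ) + (θ - m) := by abel
    rw [this, inner_add_left, real_inner_self_eq_norm_sq]
    ring
  simp_rw [hpt] at hsum
  have i1 : Integrable (fun x ↦ fderiv ℝ f x (x - θ)) (gibbs f α τ m) := by
    refine integrable_gibbs hf.continuous hmin hα hτ (A := A * (1 + ‖xs - θ‖)) (c := c + 1)
      ((hf.continuous_fderiv one_ne_zero).clm_apply (by fun_prop)) fun x ↦ ?_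
    calc _ ≤ ‖fderiv ℝ f x‖ * ‖x - θ‖ := ContinuousLinearMap.le_opNorm _ _
      _ ≤ A * Real.exp (c * ‖x - xs‖) * ((1 + ‖xs - θ‖) * Real.exp (1 * ‖x - xs‖)) := by
        gcongr
        · exact hA x
        · exact norm_sub_le_mul_exp _ _ _
      _ = _ := by rw [add_mul c 1, Real.exp_add]; ring
  have i2 : Integrable (fun x ↦ ‖x - θ‖ ^ 2) (gibbs f α τ m) := by
    refine integrable_gibbs hf.continuous hmin hα hτ (A := (1 + ‖xs - θ‖) ^ 2) (c := 2)
      (by fun_prop) fun x ↦ ?_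
    rw [Real.norm_of_nonneg (by positivity)]
    calc _ ≤ ((1 + ‖xs - θ‖) * Real.exp (1 * ‖x - xs‖)) ^ 2 := by
          gcongr; exact norm_sub_le_mul_exp _ _ _
      _ = _ := by rw [mul_pow, ← Real.exp_nat_mul]; norm_num
  have i3 : Integrable (fun x ↦ inner ℝ (θ - m) (x - θ)) (gibbs f α τ m) :=
    (hid.sub (integrable_const θ)).const_inner _
  -- Centring at the mean removes the only term that still contains `m`.
  have e3 : ∫ x, inner ℝ (θ - m) (x - θ) ∂(gibbs f α τ m) = 0 := by
    have h1 := integral_inner (𝕜 := ℝ) (hid.sub (integrable_const θ)) (θ - m)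
    simp only [Pi.sub_apply] at h1
    rw [h1, integral_sub hid (integrable_const θ)]
    simp [← hθ]
  have := integral_add (i1.add (i2.const_mul τ)) (i3.const_mul τ)
  simp only [Pi.add_apply] at this
  rw [hsum, integral_add i1 (i2.const_mul τ), integral_const_mul, integral_const_mul, e3] at this
  linarith

end GibbsMean

/-! ### Contraction estimate for the Gibbs mean -/

section GibbsMeanBound

variable {E : Type*} [NormedAddCommGroup E] [InnerProductSpace ℝ E] [FiniteDimensional ℝ E]
  [MeasurableSpace E] [BorelSpace E]
variable {f : E → ℝ} {xs : E}

lemma norm_integral_gibbs_sub_le (hf : Continuous f) (hmin : ∀ x, f xs ≤ f x)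
    {α τ D A c : ℝ} {m : E} (hα : 0 < α) (hτ : 0 < τ) (hD : 0 ≤ D)
    (hA : ∀ x, ‖x - xs‖ ≤ A * Real.exp (c * ‖x - xs‖)) :
    ‖∫ x, x ∂(gibbs f α τ m) - xs‖ ≤
      D + A * ∫ x, {x | D ≤ ‖x - xs‖}.indicator (fun x ↦ Real.exp (c * ‖x - xs‖)) x
        ∂(gibbs f α τ m) := by
  have := isProbabilityMeasure_gibbs (m := m) hf hmin hα hτ
  have hid := integrable_id_gibbs (m := m) hf hmin hα hτ
  have hA0 : 0 ≤ A := by simpa using (norm_nonneg _).trans (hA xs)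
  have hu : Integrable ({x | D ≤ ‖x - xs‖}.indicator (fun x ↦ Real.exp (c * ‖x - xs‖)))
      (gibbs f α τ m) := by
    refine (integrable_gibbs hf hmin hα hτ (A := 1) (c := c) (by fun_prop) fun x ↦ ?_).indicator
      (measurableSet_le measurable_const (by fun_prop))
    simp
  have e : ∫ x, x ∂(gibbs f α τ m) - xs = ∫ x, (x - xs) ∂(gibbs f α τ m) := by
    rw [integral_sub hid (integrable_const _)]; simp
  rw [e]
  refine (norm_integral_le_integral_norm _).trans ?_
  have e2 : D + A * ∫ x, {x | D ≤ ‖x - xs‖}.indicator (fun x ↦ Real.exp (c * ‖x - xs‖)) x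
        ∂(gibbs f α τ m) =
      ∫ x, D + A * {x | D ≤ ‖x - xs‖}.indicator (fun x ↦ Real.exp (c * ‖x - xs‖)) x
        ∂(gibbs f α τ m) := by
    rw [integral_add (integrable_const _) (hu.const_mul A), integral_const_mul]; simp
  rw [e2]
  refine integral_mono (hid.sub (integrable_const _)).norm
    ((integrable_const _).add (hu.const_mul A)) fun x ↦ ?_
  by_cases hx : D ≤ ‖x - xs‖
  · rw [Set.indicator_of_mem (by exact hx)]
    have := hA x
    dsimp only
    linarith
  · rw [Set.indicator_of_notMem (by exact hx)]
    push Not at hx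
    dsimp only
    linarith

/-- If the regularized potential concentrates in a ball where `f` is strongly convex, then the
mean of the Gibbs measure satisfies the contraction estimate of the proximal map,
up to an error of order `α⁻¹`. -/
lemma exists_gibbs_mean_contraction (hf : ContDiff ℝ 3 f) (hmin : ∀ x, f xs ≤ f x)
    (hF : ∀ c : ℝ, 0 < c → ∃ A : ℝ, 0 ≤ A ∧ ∀ x, ‖fderiv ℝ f x‖ ≤ A * Real.exp (c * ‖x - xs‖))
    {δ lam : ℝ} (hlam : 0 < lam) (hconv : StrongConvexOn (Metric.ball xs δ) lam f)
    {c₀ D ε : ℝ} (hc₀ : 0 < c₀) (hD : 0 < D) (hDδ : D < δ) (hε : 0 < ε) :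
    ∃ C α₁ : ℝ, 0 ≤ C ∧ 1 ≤ α₁ ∧ ∀ (α τ G : ℝ) (m : E), α₁ ≤ α → 0 < τ →
      (∀ x ∈ Metric.ball xs ε, f x + τ / 2 * ‖x - m‖ ^ 2 ≤ G + c₀ * D / 4) →
      (∀ x, D ≤ ‖x - xs‖ → G + c₀ * ‖x - xs‖ ≤ f x + τ / 2 * ‖x - m‖ ^ 2) →
      (lam + τ) * ‖∫ x, x ∂(gibbs f α τ m) - xs‖ ≤ τ * ‖m - xs‖ + C / α := by
  have hf1 : ContDiff ℝ 1 f := hf.of_le (by norm_num)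
  have hF2 : ContDiff ℝ 2 (fderiv ℝ f) := hf.fderiv_right (by norm_num)
  have hdiff : Differentiable ℝ f := hf1.differentiable one_ne_zero
  have hcF : Continuous (fderiv ℝ f) := hF2.continuous
  have hcF' : Continuous (fderiv ℝ (fderiv ℝ f)) := hF2.continuous_fderiv two_ne_zero
  have hδ : 0 < δ := hD.trans hDδ
  obtain ⟨Ct, hCt, htail⟩ := exists_tail_bound f xs hf.continuous hmin hc₀ hD hε
  -- Rate `c₀ / 8`, because products of two such factors must be dominated by the weight `exp (c₀ r
  -- / 4)` of the tail bound.
  obtain ⟨A, hA, hAF⟩ := hF (c₀ / 8) (by positivity)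
  obtain ⟨N, hN, hNexp⟩ := exists_one_add_rpow_le_exp 1 (show 0 < c₀ / 8 by positivity)
  obtain ⟨C₂, hC₂, hTaylor⟩ := hF2.exists_norm_sub_sub_fderiv_le xs δ
  obtain ⟨H, hH⟩ := (isCompact_closedBall xs δ).exists_bound_of_continuousOn
    (f := fderiv ℝ (fderiv ℝ f)) hcF'.continuousOn
  have hH0 : 0 ≤ H := (norm_nonneg _).trans (hH xs (Metric.mem_closedBall_self hδ.le))
  set A₃ : ℝ := N + δ
  set A₄ : ℝ := A + A * Real.exp (c₀ / 8 * δ)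
  have hA₃ : 0 ≤ A₃ := by positivity
  have hA₄ : 0 ≤ A₄ := by positivity
  set A₁ : ℝ := lam * A₃ ^ 2 + A₄ * A₃
  set A₂ : ℝ := A₄ + H * A₃
  have hA₁ : 0 ≤ A₁ := by positivity
  have hA₂ : 0 ≤ A₂ := by positivity
  set d : ℝ := ((Module.finrank ℝ E : ℕ) : ℝ)
  -- `(d + A₁ Ct) / lam` bounds `α` times the variance. The threshold on `α` makes `D + A₃ Ct / α <
  -- δ`, so that the mean itself lies in the ball of strong convexity.
  refine ⟨C₂ * ((d + A₁ * Ct) / lam) + A₂ * Ct, max 1 (A₃ * Ct / (δ - D) + 1), by positivity,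
    le_max_left _ _, fun α τ G m hα hτ H1 H2 ↦ ?_⟩
  have hα1 : 1 ≤ α := (le_max_left _ _).trans hα
  have hα0 : 0 < α := by linarith
  have hα2 : A₃ * Ct / (δ - D) < α := by linarith [(le_max_right _ _).trans hα]
  have htl := htail α τ G D m hα1 hτ le_rfl H1 H2
  have hprob := isProbabilityMeasure_gibbs (m := m) hf.continuous hmin hα0 hτ
  have hid := integrable_id_gibbs (m := m) hf.continuous hmin hα0 hτ
  set π := gibbs f α τ m
  set u : E → ℝ := {x | D ≤ ‖x - xs‖}.indicator (fun x ↦ Real.exp (c₀ / 4 * ‖x - xs‖))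
  have hu : Integrable u π := by
    refine (integrable_gibbs hf.continuous hmin hα0 hτ (A := 1) (c := c₀ / 4) (by fun_prop)
      fun x ↦ ?_).indicator (measurableSet_le measurable_const (by fun_prop))
    simp
  have hu0 : 0 ≤ ∫ x, u x ∂π :=
    integral_nonneg fun x ↦ Set.indicator_nonneg (fun _ _ ↦ (Real.exp_pos _).le) _
  have hexp1 : ∀ x : E, 1 ≤ Real.exp (c₀ / 8 * ‖x - xs‖) := fun x ↦
    Real.one_le_exp (by positivity)
  have hexp2 : ∀ x : E, Real.exp (c₀ / 4 * ‖x - xs‖) = Real.exp (c₀ / 8 * ‖x - xs‖) ^ 2 := by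
    intro x
    rw [← Real.exp_nat_mul]; ring_nf
  have hr : ∀ x : E, ‖x - xs‖ + δ ≤ A₃ * Real.exp (c₀ / 8 * ‖x - xs‖) := by
    intro x
    have h1 := hNexp ‖x - xs‖ (norm_nonneg _)
    rw [Real.rpow_one] at h1
    have h2 := hexp1 x
    simp only [A₃]
    nlinarith
  set θ : E := ∫ x, x ∂π with hθ
  have hθball : θ ∈ Metric.ball xs δ := by
    rw [mem_ball_iff_norm]
    have h1 := norm_integral_gibbs_sub_le (m := m) (A := A₃) (c := c₀ / 4) hf.continuous hmin hα0 hτ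
      hD.le fun x ↦ by
        rw [hexp2]
        have := hr x
        have := hexp1 x
        nlinarith [norm_nonneg (x - xs)]
    have h2 : A₃ * ∫ x, u x ∂π ≤ A₃ * (Ct / α) := by gcongr
    have h3 : A₃ * (Ct / α) < δ - D := by
      rw [div_lt_iff₀ (by linarith)] at hα2
      rw [← mul_div_assoc, div_lt_iff₀ hα0]
      linarith
    linarith
  have hθcl := Metric.ball_subset_closedBall hθball
  have hθr : ‖θ - xs‖ ≤ δ := (mem_ball_iff_norm.1 hθball).le
  have hxθ : ∀ x, ‖x - θ‖ ≤ A₃ * Real.exp (c₀ / 8 * ‖x - xs‖) := by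
    intro x
    have h1 : ‖x - θ‖ ≤ ‖x - xs‖ + ‖xs - θ‖ := by simpa using norm_add_le (x - xs) (xs - θ)
    rw [norm_sub_rev xs θ] at h1
    linarith [hr x]
  have hFθ : ∀ x, ‖fderiv ℝ f x - fderiv ℝ f θ‖ ≤ A₄ * Real.exp (c₀ / 8 * ‖x - xs‖) := by
    intro x
    have h1 : ‖fderiv ℝ f θ‖ ≤ A * Real.exp (c₀ / 8 * δ) := (hAF θ).trans (by gcongr)
    have h2 : A * Real.exp (c₀ / 8 * δ) ≤
        A * Real.exp (c₀ / 8 * δ) * Real.exp (c₀ / 8 * ‖x - xs‖) :=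
      le_mul_of_one_le_right (by positivity) (hexp1 x)
    have := norm_sub_le (fderiv ℝ f x) (fderiv ℝ f θ)
    have := hAF x
    simp only [A₄]
    linarith
  -- Strong monotonicity holds within radius `D`; beyond it, any violation is absorbed by a multiple
  -- of the tail weight `u`. The Taylor estimate `b2` is globalized in the same way.
  have b1 : ∀ x, lam * ‖x - θ‖ ^ 2 ≤ fderiv ℝ f x (x - θ) - fderiv ℝ f θ (x - θ) + A₁ * u x := by
    intro x
    by_cases hx : D ≤ ‖x - xs‖
    · have hux : u x = Real.exp (c₀ / 8 * ‖x - xs‖) ^ 2 := by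
        rw [← hexp2]; exact Set.indicator_of_mem (by exact hx) _
      rw [hux]
      have h1 : |fderiv ℝ f x (x - θ) - fderiv ℝ f θ (x - θ)| ≤
          (A₄ * Real.exp (c₀ / 8 * ‖x - xs‖)) * (A₃ * Real.exp (c₀ / 8 * ‖x - xs‖)) := by
        have := (fderiv ℝ f x - fderiv ℝ f θ).le_opNorm (x - θ)
        rw [sub_apply, Real.norm_eq_abs] at this
        exact this.trans (mul_le_mul (hFθ x) (hxθ x) (norm_nonneg _) (by positivity))
      have h2 : lam * ‖x - θ‖ ^ 2 ≤ lam * (A₃ * Real.exp (c₀ / 8 * ‖x - xs‖)) ^ 2 := by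
        gcongr; exact hxθ x
      have h3 := (abs_le.1 h1).1
      simp only [A₁]
      linarith
    · have hux : u x = 0 := Set.indicator_of_notMem (by exact hx) _
      rw [hux, mul_zero, add_zero]
      push Not at hx
      exact hconv.le_fderiv_sub_fderiv hdiff (mem_ball_iff_norm.2 (hx.trans hDδ)) hθball
  have b2 : ∀ x, ‖fderiv ℝ f x - fderiv ℝ f θ - fderiv ℝ (fderiv ℝ f) θ (x - θ)‖ ≤
      C₂ * ‖x - θ‖ ^ 2 + A₂ * u x := by
    intro x
    by_cases hx : D ≤ ‖x - xs‖
    · have hux : u x = Real.exp (c₀ / 8 * ‖x - xs‖) ^ 2 := by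
        rw [← hexp2]; exact Set.indicator_of_mem (by exact hx) _
      rw [hux]
      have h1 : ‖fderiv ℝ (fderiv ℝ f) θ (x - θ)‖ ≤ H * (A₃ * Real.exp (c₀ / 8 * ‖x - xs‖)) :=
        (ContinuousLinearMap.le_opNorm _ _).trans
          (mul_le_mul (hH θ hθcl) (hxθ x) (norm_nonneg _) hH0)
      have h2 := norm_sub_le (fderiv ℝ f x - fderiv ℝ f θ) (fderiv ℝ (fderiv ℝ f) θ (x - θ))
      have h3 := hFθ x
      have h4 : A₂ * Real.exp (c₀ / 8 * ‖x - xs‖) ≤ A₂ * Real.exp (c₀ / 8 * ‖x - xs‖) ^ 2 := by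
        gcongr
        exact le_self_pow₀ (hexp1 x) two_ne_zero
      have h5 : A₂ * Real.exp (c₀ / 8 * ‖x - xs‖) = A₄ * Real.exp (c₀ / 8 * ‖x - xs‖)
        + H * (A₃ * Real.exp (c₀ / 8 * ‖x - xs‖)) := by simp only [A₂]; ring
      have h6 : 0 ≤ C₂ * ‖x - θ‖ ^ 2 := by positivity
      linarith
    · have hux : u x = 0 := Set.indicator_of_notMem (by exact hx) _
      rw [hux, mul_zero, add_zero]
      push Not at hx
      exact hTaylor x (mem_closedBall_iff_norm.2 (hx.trans hDδ).le) θ hθcl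
  have hsub : Integrable (fun x ↦ x - θ) π := hid.sub (integrable_const θ)
  have hsub0 : ∫ x, (x - θ) ∂π = 0 := by
    rw [integral_sub hid (integrable_const θ)]; simp [← hθ]
  have hlin0 : ∀ (L : E →L[ℝ] ℝ), ∫ x, L (x - θ) ∂π = 0 := fun L ↦ by
    rw [L.integral_comp_comm hsub, hsub0, map_zero]
  have i1 : Integrable (fun x ↦ fderiv ℝ f x (x - θ)) π := by
    refine integrable_gibbs hf.continuous hmin hα0 hτ (A := A * A₃) (c := c₀ / 4)
      (hcF.clm_apply (by fun_prop)) fun x ↦ ?_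
    calc _ ≤ ‖fderiv ℝ f x‖ * ‖x - θ‖ := ContinuousLinearMap.le_opNorm _ _
      _ ≤ (A * Real.exp (c₀ / 8 * ‖x - xs‖)) * (A₃ * Real.exp (c₀ / 8 * ‖x - xs‖)) := by
        gcongr
        · exact hAF x
        · exact hxθ x
      _ = _ := by rw [hexp2]; ring
  have i2 : Integrable (fun x ↦ ‖x - θ‖ ^ 2) π := by
    refine integrable_gibbs hf.continuous hmin hα0 hτ (A := A₃ ^ 2) (c := c₀ / 4)
      (by fun_prop) fun x ↦ ?_
    rw [Real.norm_of_nonneg (by positivity), hexp2, ← mul_pow]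
    gcongr
    exact hxθ x
  -- Integrate `b1`: the term with the derivative at `θ` averages to zero, and the virial identity
  -- bounds the other one after `τ` times the variance is discarded.
  have hvar : lam * ∫ x, ‖x - θ‖ ^ 2 ∂π ≤ (d + A₁ * Ct) / α := by
    have h1 := integral_fderiv_sub_mean_gibbs hf1 hmin hα0 hτ hAF (m := m) hθ
    have h2 : ∫ x, lam * ‖x - θ‖ ^ 2 ∂π ≤
        ∫ x, (fderiv ℝ f x (x - θ) - fderiv ℝ f θ (x - θ) + A₁ * u x) ∂π :=
      integral_mono (i2.const_mul lam)
        ((i1.sub ((fderiv ℝ f θ).integrable_comp hsub)).add (hu.const_mul A₁)) b1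
    have h3 := integral_add (i1.sub ((fderiv ℝ f θ).integrable_comp hsub)) (hu.const_mul A₁)
    have h4 := integral_sub i1 ((fderiv ℝ f θ).integrable_comp hsub)
    simp only [Pi.sub_apply] at h3
    rw [hlin0] at h4
    rw [integral_const_mul, h3, h4, integral_const_mul] at h2
    have h5 : 0 ≤ τ * ∫ x, ‖x - θ‖ ^ 2 ∂π :=
      mul_nonneg hτ.le (integral_nonneg fun x ↦ by positivity)
    have h6 : A₁ * ∫ x, u x ∂π ≤ A₁ * (Ct / α) := by gcongr
    have h7 : (d + A₁ * Ct) / α = d / α + A₁ * (Ct / α) := by ring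
    rw [h7]
    linarith
  set v : E := θ - xs
  set K : ℝ := C₂ * ((d + A₁ * Ct) / lam) + A₂ * Ct
  have hi : Integrable (fun x ↦ fderiv ℝ f x v) π := by
    refine integrable_gibbs hf.continuous hmin hα0 hτ (A := A * ‖v‖) (c := c₀ / 8)
      (hcF.clm_apply continuous_const) fun x ↦ ?_
    calc _ ≤ ‖fderiv ℝ f x‖ * ‖v‖ := ContinuousLinearMap.le_opNorm _ _
      _ ≤ A * Real.exp (c₀ / 8 * ‖x - xs‖) * ‖v‖ := by gcongr; exact hAF x
      _ = _ := by ring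
  -- The linear Taylor term averages to zero, so exchanging `fderiv ℝ f` with the mean costs only
  -- the variance and the tail.
  have hmean : |∫ x, fderiv ℝ f x v ∂π - fderiv ℝ f θ v| ≤ K / α * ‖v‖ := by
    set L : E →L[ℝ] ℝ := (fderiv ℝ (fderiv ℝ f) θ).flip v
    have e : ∫ x, fderiv ℝ f x v ∂π - fderiv ℝ f θ v =
        ∫ x, (fderiv ℝ f x - fderiv ℝ f θ - fderiv ℝ (fderiv ℝ f) θ (x - θ)) v ∂π := by
      have h3 := integral_sub (hi.sub (integrable_const (fderiv ℝ f θ v))) (L.integrable_comp hsub)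
      have h4 := integral_sub hi (integrable_const (fderiv ℝ f θ v))
      simp only [Pi.sub_apply] at h3
      rw [hlin0, h4] at h3
      simp only [integral_const, probReal_univ, one_smul, sub_zero] at h3
      rw [← h3]
      rfl
    rw [e, ← Real.norm_eq_abs]
    calc _ ≤ ∫ x, (C₂ * ‖x - θ‖ ^ 2 + A₂ * u x) * ‖v‖ ∂π := by
          refine norm_integral_le_of_norm_le (((i2.const_mul _).add (hu.const_mul _)).mul_const _)
            (.of_forall fun x ↦ ?_)
          exact (ContinuousLinearMap.le_opNorm _ _).trans (by gcongr; exact b2 x)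
      _ = (C₂ * ∫ x, ‖x - θ‖ ^ 2 ∂π + A₂ * ∫ x, u x ∂π) * ‖v‖ := by
          rw [integral_mul_const, integral_add (i2.const_mul _) (hu.const_mul _),
            integral_const_mul, integral_const_mul]
      _ ≤ (C₂ * ((d + A₁ * Ct) / lam / α) + A₂ * (Ct / α)) * ‖v‖ := by
          gcongr
          rw [div_div, mul_comm lam α, ← div_div, le_div_iff₀ hlam]
          linarith
      _ = _ := by simp only [K]; ring
  have hfoc := integral_fderiv_gibbs hf1 hmin hα0 hτ hAF (m := m) v
  rw [← hθ] at hfoc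
  have hcrit : fderiv ℝ f xs = 0 :=
    IsLocalMin.fderiv_eq_zero (Filter.Eventually.of_forall hmin)
  have hmono := hconv.le_fderiv_sub_fderiv hdiff hθball (Metric.mem_ball_self hδ)
  rw [hcrit, zero_apply, sub_zero] at hmono
  have hinner : inner ℝ (θ - m) v = ‖v‖ ^ 2 - inner ℝ (m - xs) v := by
    have : θ - m = v - (m - xs) := by simp only [v]; abel
    rw [this, inner_sub_left, real_inner_self_eq_norm_sq]
  have hcs := real_inner_le_norm (m - xs) v
  have hcs' := mul_le_mul_of_nonneg_left hcs hτ.le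
  rw [hinner] at hfoc
  rw [hfoc] at hmean
  have h1 := (abs_le.1 hmean).1
  -- The first-order condition, strong monotonicity between `θ` and `xs`, and Cauchy–Schwarz; one
  -- factor `‖v‖` is then cancelled.
  have h2 : (lam + τ) * ‖v‖ * ‖v‖ ≤ (τ * ‖m - xs‖ + K / α) * ‖v‖ := by nlinarith
  rcases (norm_nonneg v).eq_or_lt with h0 | h0
  · rw [← h0]
    have : 0 ≤ K := by positivity
    have : 0 ≤ τ * ‖m - xs‖ + K / α := by positivity
    linarith
  · exact le_of_mul_le_mul_right h2 h0

end GibbsMeanBound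

/-! ### Concentration for weak regularization, and for centres near to or far from the minimizer -/

section Regimes

variable {E : Type*} [NormedAddCommGroup E] {f : E → ℝ} {xs : E}

lemma linear_growth_of_rpow_growth {κ β : ℝ} (hκ : 0 < κ) (hβ : 1 ≤ β)
    (hgrowth : ∀ x, f xs + κ / 2 * ‖x - xs‖ ^ β ≤ f x) {D : ℝ} (hD : 0 < D) {x : E}
    (hx : D ≤ ‖x - xs‖) : f xs + κ / 2 * D ^ (β - 1) * ‖x - xs‖ ≤ f x := by
  refine le_trans ?_ (hgrowth x)
  have hr : 0 < ‖x - xs‖ := hD.trans_le hx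
  have e : ‖x - xs‖ ^ β = ‖x - xs‖ ^ (β - 1) * ‖x - xs‖ := by
    rw [Real.rpow_sub_one hr.ne']; field_simp
  rw [e, mul_assoc]
  have h0 : 0 ≤ β - 1 := by linarith
  gcongr

variable [InnerProductSpace ℝ E]

lemma norm_sub_sq_sub_ge (x m xs : E) :
    ‖x - xs‖ ^ 2 - 2 * ‖x - xs‖ * ‖m - xs‖ ≤ ‖x - m‖ ^ 2 - ‖xs - m‖ ^ 2 := by
  have e : x - m = (x - xs) - (m - xs) := by abel
  rw [e, norm_sub_sq_real (x - xs), norm_sub_rev xs m]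
  have := real_inner_le_norm (x - xs) (m - xs)
  linarith

/-- The radius may not depend on `τ`, which is unbounded when the variance is small; hence the error
proportional to `τ` is kept apart. -/
lemma exists_ball_potential_le (hf : Continuous f) (B : ℝ) (hB : 0 ≤ B) {η₁ η₂ : ℝ} (h₁ : 0 < η₁)
    (h₂ : 0 < η₂) :
    ∃ ε : ℝ, 0 < ε ∧ ∀ x ∈ Metric.ball xs ε, ∀ (τ : ℝ) (m : E), 0 < τ → ‖m - xs‖ ≤ B →
      f x + τ / 2 * ‖x - m‖ ^ 2 ≤ f xs + τ / 2 * ‖xs - m‖ ^ 2 + η₁ + τ * η₂ := by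
  obtain ⟨ε₁, hε₁, h⟩ := Metric.continuous_iff.1 hf xs η₁ h₁
  refine ⟨min ε₁ (min 1 (η₂ / (1 + 2 * B))), by positivity, fun x hx τ m hτ hm ↦ ?_⟩
  have hx' := mem_ball_iff_norm.1 hx
  have hx1 : dist x xs < ε₁ := by rw [dist_eq_norm]; exact hx'.trans_le (min_le_left _ _)
  have hx2 : ‖x - xs‖ ≤ 1 := (hx'.trans_le ((min_le_right _ _).trans (min_le_left _ _))).le
  have hx3 : ‖x - xs‖ ≤ η₂ / (1 + 2 * B) :=
    (hx'.trans_le ((min_le_right _ _).trans (min_le_right _ _))).le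
  rw [le_div_iff₀ (by positivity)] at hx3
  have h1 := (abs_lt.1 (Real.dist_eq _ _ ▸ h x hx1)).2
  have h2 : ‖x - m‖ ^ 2 - ‖xs - m‖ ^ 2 ≤ 2 * η₂ := by
    have e : x - m = (x - xs) - (m - xs) := by abel
    rw [e, norm_sub_sq_real (x - xs), norm_sub_rev xs m]
    have h3 := neg_le_of_abs_le (abs_real_inner_le_norm (x - xs) (m - xs))
    have h4 : ‖x - xs‖ * ‖m - xs‖ ≤ ‖x - xs‖ * B := by gcongr
    nlinarith [norm_nonneg (x - xs)]
  have h3 := mul_le_mul_of_nonneg_left h2 (show 0 ≤ τ / 2 by positivity)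
  linarith

variable [FiniteDimensional ℝ E] [MeasurableSpace E] [BorelSpace E]

/-- The pull `τ ‖m - xs‖` towards `m` can equal the slope `K / 2` guaranteed by the growth condition
at radius `δ`. In that borderline case the margin comes from the quadratic term `τ r / 2`. -/
lemma exists_mean_contraction_of_le {κ β δ lam γ : ℝ} (hf : ContDiff ℝ 3 f)
    (hF : ∀ c : ℝ, 0 < c → ∃ A : ℝ, 0 ≤ A ∧ ∀ x, ‖fderiv ℝ f x‖ ≤ A * Real.exp (c * ‖x - xs‖))
    (hκ : 0 < κ) (hβ : 1 ≤ β) (hδ : 0 < δ) (hlam : 0 < lam) (hγ : 0 < γ)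
    (hmin : ∀ x, f xs ≤ f x)
    (hgrowth : ∀ x, f xs + κ / 2 * ‖x - xs‖ ^ β ≤ f x)
    (hconv : StrongConvexOn (Metric.ball xs δ) lam f) :
    ∃ C α₁ : ℝ, 0 ≤ C ∧ 1 ≤ α₁ ∧ ∀ (α τ : ℝ) (m : E), α₁ ≤ α → 0 < τ → τ ≤ 2 / γ →
      ‖m - xs‖ ≤ γ * (κ * δ ^ (β - 1)) / 4 →
      ‖∫ x, x ∂(gibbs f α τ m) - xs‖ ≤ (1 - (1 + 2 / (γ * lam))⁻¹) * ‖m - xs‖ + C / α := by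
  set K := κ * δ ^ (β - 1)
  have hK : 0 < K := by positivity
  -- The slope lost by taking `D < δ` is `η / 2`. For `τ ≤ 1 / γ` the pull is at most `K / 4`, and
  -- `K / 8` remains; for `τ ≥ 1 / γ` the quadratic term gives `δ / (4 γ)`, twice the largest loss.
  set η := min (K / 4) (δ / (4 * γ))
  have hη : 0 < η := by positivity
  obtain ⟨D, hD2, hDδ, hDK⟩ : ∃ D, δ / 2 ≤ D ∧ D < δ ∧ K - η ≤ κ * D ^ (β - 1) := by
    have hc : ContinuousAt (fun D : ℝ ↦ κ * D ^ (β - 1)) δ :=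
      continuousAt_const.mul (Real.continuousAt_rpow_const _ _ (Or.inl hδ.ne'))
    have h1 : ∀ᶠ D in nhdsWithin δ (Set.Iio δ), K - η < κ * D ^ (β - 1) :=
      (hc.tendsto.mono_left nhdsWithin_le_nhds).eventually (lt_mem_nhds (by linarith))
    have h2 : Set.Ioo (δ / 2) δ ∈ nhdsWithin δ (Set.Iio δ) := Ioo_mem_nhdsLT (by linarith)
    obtain ⟨D, h3, h4⟩ := (h1.and h2).exists
    exact ⟨D, h4.1.le, h4.2, h3.le⟩
  have hD : 0 < D := by linarith
  set c₀ := min (K / 8) (δ / (8 * γ))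
  have hc₀ : 0 < c₀ := by positivity
  obtain ⟨ε, hε, hball⟩ := exists_ball_potential_le (xs := xs) hf.continuous (γ * K / 4)
    (by positivity)
    (show 0 < c₀ * D / 8 by positivity) (show 0 < γ / 2 * (c₀ * D / 8) by positivity)
  obtain ⟨C, α₁, hC, hα₁, hmain⟩ :=
    exists_gibbs_mean_contraction hf hmin hF hlam hconv hc₀ hD hDδ hε
  refine ⟨C / lam, α₁, by positivity, hα₁, fun α τ m hα hτ hτγ hm ↦ ?_⟩
  have hα0 : 0 < α := by linarith
  have h := hmain α τ (f xs + τ / 2 * ‖xs - m‖ ^ 2) m hα hτ (fun x hx ↦ ?_) (fun x hx ↦ ?_)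
  -- The ratio `τ / (lam + τ)` increases with `τ`, and its value at `2 / γ` is the contraction
  -- factor.
  · have hq : τ ≤ (1 - (1 + 2 / (γ * lam))⁻¹) * (lam + τ) := by
      have e : 1 - (1 + 2 / (γ * lam))⁻¹ = (2 / γ) / (lam + 2 / γ) := by field_simp; ring
      rw [e, div_mul_eq_mul_div, le_div_iff₀ (by positivity)]
      nlinarith
    have h1 : (lam + τ) * ‖∫ x, x ∂(gibbs f α τ m) - xs‖ ≤
        (lam + τ) * ((1 - (1 + 2 / (γ * lam))⁻¹) * ‖m - xs‖ + C / lam / α) := by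
      refine h.trans ?_
      have h2 := mul_le_mul_of_nonneg_right hq (norm_nonneg (m - xs))
      have h3 : C / α = lam * (C / lam / α) := by field_simp
      have h4 : 0 ≤ τ * (C / lam / α) := by positivity
      rw [h3]
      linarith
    exact le_of_mul_le_mul_left h1 (by positivity)
  · have h1 := hball x hx τ m hτ hm
    have h2 : τ * (γ / 2 * (c₀ * D / 8)) ≤ 2 / γ * (γ / 2 * (c₀ * D / 8)) := by gcongr
    have h3 : 2 / γ * (γ / 2 * (c₀ * D / 8)) = c₀ * D / 8 := by field_simp
    linarith
  · have h1 := linear_growth_of_rpow_growth hκ hβ hgrowth hD hx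
    have h2 := mul_le_mul_of_nonneg_left (norm_sub_sq_sub_ge x m xs) (show 0 ≤ τ / 2 by positivity)
    set r := ‖x - xs‖
    have hr : 0 < r := hD.trans_le hx
    have hbr : c₀ ≤ (K - η) / 2 - τ * ‖m - xs‖ + τ * r / 2 := by
      have hη1 : η ≤ K / 4 := min_le_left _ _
      have hη2 : η ≤ δ / (4 * γ) := min_le_right _ _
      have hc1 : c₀ ≤ K / 8 := min_le_left _ _
      have hc2 : c₀ ≤ δ / (8 * γ) := min_le_right _ _
      have hτm : τ * ‖m - xs‖ ≤ τ * (γ * K / 4) := by gcongr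
      rcases le_total τ (1 / γ) with hcase | hcase
      · have h3 : τ * (γ * K / 4) ≤ 1 / γ * (γ * K / 4) := by gcongr
        have h4 : 1 / γ * (γ * K / 4) = K / 4 := by field_simp
        have h5 : 0 ≤ τ * r := by positivity
        linarith
      · have h3 : τ * (γ * K / 4) ≤ 2 / γ * (γ * K / 4) := by gcongr
        have h4 : 2 / γ * (γ * K / 4) = K / 2 := by field_simp; norm_num
        have h5 : 1 / γ * (δ / 2) ≤ τ * r := by
          gcongr
          exact hD2.trans hx
        have h6 : 1 / γ * (δ / 2) = 4 * (δ / (8 * γ)) := by field_simp; norm_num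
        have h7 : δ / (4 * γ) = 2 * (δ / (8 * γ)) := by field_simp; norm_num
        linarith
    have h3 := mul_le_mul_of_nonneg_right hbr hr.le
    have h4 : (K - η) / 2 * r ≤ κ / 2 * D ^ (β - 1) * r := by
      gcongr
      linarith
    linarith

/-- Here `τ` is arbitrary. For `r ≥ D ≥ 4 ‖m - xs‖` one has `r² - 2 r ‖m - xs‖ ≥ D² / 2`; the
resulting gain `τ D² / 4` is put into the level `G`, where it absorbs the oscillation of the
quadratic term on the small ball. -/
lemma exists_mean_bound_near {κ β δ lam : ℝ} (hf : ContDiff ℝ 3 f)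
    (hF : ∀ c : ℝ, 0 < c → ∃ A : ℝ, 0 ≤ A ∧ ∀ x, ‖fderiv ℝ f x‖ ≤ A * Real.exp (c * ‖x - xs‖))
    (hκ : 0 < κ) (hβ : 1 ≤ β) (hδ : 0 < δ) (hlam : 0 < lam)
    (hmin : ∀ x, f xs ≤ f x)
    (hgrowth : ∀ x, f xs + κ / 2 * ‖x - xs‖ ^ β ≤ f x)
    (hconv : StrongConvexOn (Metric.ball xs δ) lam f) :
    ∃ C α₁ : ℝ, 0 ≤ C ∧ 1 ≤ α₁ ∧ ∀ (α τ : ℝ) (m : E), α₁ ≤ α → 0 < τ → ‖m - xs‖ ≤ δ / 8 →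
      ‖∫ x, x ∂(gibbs f α τ m) - xs‖ ≤ ‖m - xs‖ + C / α := by
  set D := δ / 2
  have hD : 0 < D := by positivity
  set c₀ := κ / 2 * D ^ (β - 1)
  have hc₀ : 0 < c₀ := by positivity
  obtain ⟨ε, hε, hball⟩ := exists_ball_potential_le (xs := xs) hf.continuous (δ / 8) (by positivity)
    (show 0 < c₀ * D / 4 by positivity) (show 0 < D ^ 2 / 4 by positivity)
  obtain ⟨C, α₁, hC, hα₁, hmain⟩ :=
    exists_gibbs_mean_contraction hf hmin hF hlam hconv hc₀ hD (by simp only [D]; linarith) hε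
  refine ⟨C / lam, α₁, by positivity, hα₁, fun α τ m hα hτ hm ↦ ?_⟩
  have hα0 : 0 < α := by linarith
  have h := hmain α τ (f xs + τ / 2 * ‖xs - m‖ ^ 2 + τ * (D ^ 2 / 4)) m hα hτ
    (fun x hx ↦ ?_) (fun x hx ↦ ?_)
  · have h1 : (lam + τ) * ‖∫ x, x ∂(gibbs f α τ m) - xs‖ ≤
        (lam + τ) * (‖m - xs‖ + C / lam / α) := by
      refine h.trans ?_
      have h2 : 0 ≤ lam * ‖m - xs‖ := by positivity
      have h3 : C / α = lam * (C / lam / α) := by field_simp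
      have h4 : 0 ≤ τ * (C / lam / α) := by positivity
      rw [h3]
      linarith
    exact le_of_mul_le_mul_left h1 (by positivity)
  · have h1 := hball x hx τ m hτ hm
    linarith
  · have h1 : f xs + c₀ * ‖x - xs‖ ≤ f x :=
      linear_growth_of_rpow_growth hκ hβ hgrowth hD hx
    have h2 := mul_le_mul_of_nonneg_left (norm_sub_sq_sub_ge x m xs) (show 0 ≤ τ / 2 by positivity)
    set r := ‖x - xs‖
    have h3 : D ^ 2 / 2 ≤ r ^ 2 - 2 * r * ‖m - xs‖ := by
      have : ‖m - xs‖ ≤ D / 4 := by simp only [D]; linarith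
      nlinarith [norm_nonneg (m - xs)]
    have h4 := mul_le_mul_of_nonneg_left h3 (show 0 ≤ τ / 2 by positivity)
    linarith

/-- For `r ≥ 3 ‖m - xs‖` the quadratic term again helps, since `r² - 2 r ‖m - xs‖ ≥ r² / 3`. Thus `3
‖m - xs‖` serves as the tail radius `D'`, and no convexity enters. -/
lemma exists_mean_bound_far {κ β δ B : ℝ} (hf : Continuous f)
    (hκ : 0 < κ) (hβ : 1 ≤ β) (hδ : 0 < δ) (hB : 0 ≤ B)
    (hmin : ∀ x, f xs ≤ f x)
    (hgrowth : ∀ x, f xs + κ / 2 * ‖x - xs‖ ^ β ≤ f x) :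
    ∃ C : ℝ, 0 ≤ C ∧ ∀ (α τ : ℝ) (m : E), 1 ≤ α → 0 < τ → δ / 8 ≤ ‖m - xs‖ → ‖m - xs‖ ≤ B →
      ‖∫ x, x ∂(gibbs f α τ m) - xs‖ ≤ 3 * ‖m - xs‖ + C / α := by
  set D := 3 * (δ / 8)
  have hD : 0 < D := by positivity
  set c₀ := κ / 2 * D ^ (β - 1)
  have hc₀ : 0 < c₀ := by positivity
  obtain ⟨ε, hε, hball⟩ := exists_ball_potential_le (xs := xs) hf B hB
    (show 0 < c₀ * D / 4 by positivity) (show 0 < D ^ 2 / 6 by positivity)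
  obtain ⟨Ct, hCt, htail⟩ := exists_tail_bound f xs hf hmin hc₀ hD hε
  obtain ⟨N, hN, hNexp⟩ := exists_one_add_rpow_le_exp 1 (show 0 < c₀ / 4 by positivity)
  refine ⟨N * Ct, by positivity, fun α τ m hα hτ hm hmB ↦ ?_⟩
  have hα0 : 0 < α := by linarith
  have hD' : D ≤ 3 * ‖m - xs‖ := by simp only [D]; linarith
  have h := htail α τ (f xs + τ / 2 * ‖xs - m‖ ^ 2 + τ * (D ^ 2 / 6)) (3 * ‖m - xs‖) m hα hτ hD'
    (fun x hx ↦ ?_) (fun x hx ↦ ?_)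
  · have h1 := norm_integral_gibbs_sub_le (m := m) (A := N) (c := c₀ / 4) hf hmin hα0 hτ
      (show 0 ≤ 3 * ‖m - xs‖ by positivity) fun x ↦ by
        have := hNexp ‖x - xs‖ (norm_nonneg _)
        rw [Real.rpow_one] at this
        linarith
    have h2 := mul_le_mul_of_nonneg_left h hN
    rw [mul_div_assoc]
    linarith
  · have h1 := hball x hx τ m hτ hmB
    linarith
  · have h1 : f xs + c₀ * ‖x - xs‖ ≤ f x :=
      linear_growth_of_rpow_growth hκ hβ hgrowth hD (hD'.trans hx)
    have h2 := mul_le_mul_of_nonneg_left (norm_sub_sq_sub_ge x m xs) (show 0 ≤ τ / 2 by positivity)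
    set r := ‖x - xs‖
    have h3 : D ^ 2 / 3 ≤ r ^ 2 - 2 * r * ‖m - xs‖ := by
      nlinarith [norm_nonneg (m - xs)]
    have h4 := mul_le_mul_of_nonneg_left h3 (show 0 ≤ τ / 2 by positivity)
    linarith

/-- Uniform bounds on the mean of the Gibbs measure: a contraction towards the minimizer for weak
regularization, and at most tripling of the distance to it in general. -/
lemma exists_mean_bounds {κ β δ lam γ : ℝ} (hf : ContDiff ℝ 3 f)
    (hF : ∀ c : ℝ, 0 < c → ∃ A : ℝ, 0 ≤ A ∧ ∀ x, ‖fderiv ℝ f x‖ ≤ A * Real.exp (c * ‖x - xs‖))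
    (hκ : 0 < κ) (hβ : 1 ≤ β) (hδ : 0 < δ) (hlam : 0 < lam) (hγ : 0 < γ)
    (hmin : ∀ x, f xs ≤ f x)
    (hgrowth : ∀ x, f xs + κ / 2 * ‖x - xs‖ ^ β ≤ f x)
    (hconv : StrongConvexOn (Metric.ball xs δ) lam f) :
    ∃ C α₁ : ℝ, 0 ≤ C ∧ 1 ≤ α₁ ∧ ∀ (α τ : ℝ) (m : E), α₁ ≤ α → 0 < τ →
      ‖m - xs‖ ≤ γ * (κ * δ ^ (β - 1)) / 4 →
      (τ ≤ 2 / γ → ‖∫ x, x ∂(gibbs f α τ m) - xs‖ ≤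
        (1 - (1 + 2 / (γ * lam))⁻¹) * ‖m - xs‖ + C / α) ∧
      ‖∫ x, x ∂(gibbs f α τ m) - xs‖ ≤ 3 * ‖m - xs‖ + C / α := by
  obtain ⟨C₁, a₁, hC₁, ha₁, h₁⟩ :=
    exists_mean_contraction_of_le hf hF hκ hβ hδ hlam hγ hmin hgrowth hconv
  obtain ⟨C₂, a₂, hC₂, ha₂, h₂⟩ := exists_mean_bound_near hf hF hκ hβ hδ hlam hmin hgrowth hconv
  obtain ⟨C₃, hC₃, h₃⟩ := exists_mean_bound_far hf.continuous hκ hβ hδ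
    (show 0 ≤ γ * (κ * δ ^ (β - 1)) / 4 by positivity) hmin hgrowth
  refine ⟨C₁ + C₂ + C₃, max a₁ a₂, by positivity, ha₁.trans (le_max_left _ _),
    fun α τ m hα hτ hm ↦ ?_⟩
  have hα1 : a₁ ≤ α := (le_max_left _ _).trans hα
  have hα2 : a₂ ≤ α := (le_max_right _ _).trans hα
  have hα0 : 0 < α := by linarith
  have e : (C₁ + C₂ + C₃) / α = C₁ / α + C₂ / α + C₃ / α := by ring
  have p₁ : 0 ≤ C₁ / α := by positivity
  have p₂ : 0 ≤ C₂ / α := by positivity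
  have p₃ : 0 ≤ C₃ / α := by positivity
  refine ⟨fun hτγ ↦ ?_, ?_⟩
  · linarith [h₁ α τ m hα1 hτ hτγ hm]
  · rcases le_total ‖m - xs‖ (δ / 8) with hcase | hcase
    · linarith [h₂ α τ m hα2 hτ hcase, norm_nonneg (m - xs)]
    · linarith [h₃ α τ m (by linarith) hτ hcase hm]

end Regimes

/-! ### Isotropic Gaussian laws and their consensus points -/

section GaussianLaw

variable {d : ℕ}

lemma posSemidef_smul_one {s : ℝ} (hs : 0 ≤ s) : (s • (1 : Matrix (Fin d) (Fin d) ℝ)).PosSemidef :=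
  Matrix.PosSemidef.one.smul hs

lemma charFun_isotropicGaussian (m : EuclideanSpace ℝ (Fin d)) {s : ℝ} (hs : 0 ≤ s)
    (ξ : EuclideanSpace ℝ (Fin d)) :
    charFun (multivariateGaussian m (s • (1 : Matrix (Fin d) (Fin d) ℝ))) ξ =
      Complex.exp (inner ℝ ξ m * Complex.I - (s * ‖ξ‖ ^ 2 : ℝ) / 2) := by
  rw [charFun_multivariateGaussian (posSemidef_smul_one hs)]
  congr 3
  rw [Matrix.smul_mulVec, Matrix.one_mulVec, dotProduct_smul, EuclideanSpace.norm_sq_eq,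
    smul_eq_mul]
  simp [dotProduct, pow_two]

/-- Both sides have the same characteristic function. The case `s = 0` is a Dirac mass and has to be
excluded. -/
lemma isotropicGaussian_eq_tilted (m : EuclideanSpace ℝ (Fin d)) {s : ℝ} (hs : 0 < s) :
    multivariateGaussian m (s • (1 : Matrix (Fin d) (Fin d) ℝ)) =
      volume.tilted (fun x ↦ -((2 * s)⁻¹ * ‖x - m‖ ^ 2)) := by
  have hint : Integrable
      (fun x : EuclideanSpace ℝ (Fin d) ↦ Real.exp (-((2 * s)⁻¹ * ‖x - m‖ ^ 2))) := by
    have := integrable_exp_potential (f := fun _ : EuclideanSpace ℝ (Fin d) ↦ (0 : ℝ)) (xs := 0)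
      (m := m) (α := 1) (τ := s⁻¹) continuous_const (fun _ ↦ le_rfl) one_pos (by positivity)
    refine this.congr (.of_forall fun x ↦ ?_)
    simp only
    congr 2
    field_simp
    ring
  have := isProbabilityMeasure_tilted hint
  refine Measure.ext_of_charFun (funext fun ξ ↦ ?_)
  rw [charFun_isotropicGaussian m hs.le, charFun_apply, integral_tilted]
  have hb : 0 < (((2 * s)⁻¹ : ℝ) : ℂ).re := by rw [Complex.ofReal_re]; positivity
  set Z : ℝ := ∫ x : EuclideanSpace ℝ (Fin d), Real.exp (-((2 * s)⁻¹ * ‖x - m‖ ^ 2)) with hZ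
  have hZpos : 0 < Z := integral_exp_pos hint
  have hZ' : (Z : ℂ) = ∫ v : EuclideanSpace ℝ (Fin d),
      Complex.exp (-(((2 * s)⁻¹ : ℝ) : ℂ) * (‖v‖ : ℂ) ^ 2) := by
    rw [hZ, integral_sub_right_eq_self
      (fun x : EuclideanSpace ℝ (Fin d) ↦ Real.exp (-((2 * s)⁻¹ * ‖x‖ ^ 2))) m,
      ← integral_complex_ofReal]
    congr 1 with v
    push_cast
    ring_nf
  have e : ∀ x : EuclideanSpace ℝ (Fin d), (Real.exp (-((2 * s)⁻¹ * ‖x - m‖ ^ 2)) / Z) •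
      Complex.exp (inner ℝ x ξ * Complex.I) =
      ((Z : ℂ)⁻¹ * Complex.exp (inner ℝ ξ m * Complex.I)) *
        Complex.exp (-(((2 * s)⁻¹ : ℝ) : ℂ) * (‖x - m‖ : ℂ) ^ 2
          + Complex.I * (inner ℝ ξ (x - m) : ℝ)) := by
    intro x
    have h1 : inner ℝ x ξ = inner ℝ ξ m + inner ℝ ξ (x - m) := by
      rw [← inner_add_right, real_inner_comm]; simp
    rw [h1, Complex.real_smul]
    push_cast
    rw [add_mul, Complex.exp_add, Complex.exp_add]
    ring_nf
  simp_rw [e]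
  rw [integral_const_mul, integral_sub_right_eq_self
    (fun x : EuclideanSpace ℝ (Fin d) ↦ Complex.exp (-(((2 * s)⁻¹ : ℝ) : ℂ) * (‖x‖ : ℂ) ^ 2
          + Complex.I * (inner ℝ ξ x : ℝ))) m,
    GaussianFourier.integral_cexp_neg_mul_sq_norm_add hb,
    ← GaussianFourier.integral_cexp_neg_mul_sq_norm hb, ← hZ']
  have hZ0 : (Z : ℂ) ≠ 0 := by exact_mod_cast hZpos.ne'
  have e2 : Complex.I ^ 2 * (‖ξ‖ : ℂ) ^ 2 / (4 * (((2 * s)⁻¹ : ℝ) : ℂ)) =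
      -(((s * ‖ξ‖ ^ 2 : ℝ) : ℂ) / 2) := by
    rw [Complex.I_sq]
    push_cast
    have : (s : ℂ) ≠ 0 := by exact_mod_cast hs.ne'
    field_simp
    norm_num
  rw [e2, sub_eq_add_neg, Complex.exp_add]
  field_simp

/-- Successive tiltings add their exponents, and `1 / (2 s) = α τ / 2` for `τ = (α s)⁻¹`. -/
lemma consensusPoint_isotropicGaussian {f : EuclideanSpace ℝ (Fin d) → ℝ} {α s : ℝ} (hα : 0 < α)
    (hs : 0 < s) (m : EuclideanSpace ℝ (Fin d)) :
    consensusPoint f α (multivariateGaussian m (s • (1 : Matrix (Fin d) (Fin d) ℝ))) =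
      ∫ x, x ∂(gibbs f α (α * s)⁻¹ m) := by
  have h1 : ∀ ρ : Measure (EuclideanSpace ℝ (Fin d)),
      consensusPoint f α ρ = ∫ x, x ∂(ρ.tilted (fun x ↦ -α * f x)) := by
    intro ρ
    rw [integral_tilted, consensusPoint, ← integral_smul]
    congr 1 with x
    rw [smul_smul, div_eq_inv_mul]
  have hint : Integrable
      (fun x : EuclideanSpace ℝ (Fin d) ↦ Real.exp (-((2 * s)⁻¹ * ‖x - m‖ ^ 2))) := by
    -- Were the integral `0`, division by it would make the tilted measure zero, whereas it equals a
    -- Gaussian probability measure.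
    refine Integrable.of_integral_ne_zero fun h0 ↦ ?_
    have h2 := isotropicGaussian_eq_tilted m hs
    have h3 : volume.tilted (fun x : EuclideanSpace ℝ (Fin d) ↦ -((2 * s)⁻¹ * ‖x - m‖ ^ 2)) = 0 := by
      rw [Measure.tilted, h0]
      simp
    rw [h3] at h2
    exact IsProbabilityMeasure.ne_zero _ h2
  rw [h1, isotropicGaussian_eq_tilted m hs, tilted_tilted hint, gibbs]
  congr 2 with x
  simp only [Pi.add_apply]
  field_simp
  ring

lemma secondMoment_isotropicGaussian (m y : EuclideanSpace ℝ (Fin d)) {s : ℝ} (hs : 0 ≤ s) :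
    Integrable (fun x ↦ ‖x - y‖ ^ 2)
      (multivariateGaussian m (s • (1 : Matrix (Fin d) (Fin d) ℝ))) ∧
    ∫ x, ‖x - y‖ ^ 2 ∂(multivariateGaussian m (s • (1 : Matrix (Fin d) (Fin d) ℝ))) =
      ‖m - y‖ ^ 2 + d * s := by
  set ρ := multivariateGaussian m (s • (1 : Matrix (Fin d) (Fin d) ℝ))
  have hL : MemLp (fun x : EuclideanSpace ℝ (Fin d) ↦ x) 2 ρ := IsGaussian.memLp_two_id
  have hi : ∀ i, MemLp (fun x : EuclideanSpace ℝ (Fin d) ↦ x i) 2 ρ := fun i ↦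
    (EuclideanSpace.proj (𝕜 := ℝ) i).comp_memLp' hL
  have hiy : ∀ i, MemLp (fun x : EuclideanSpace ℝ (Fin d) ↦ x i - y i) 2 ρ := fun i ↦
    (hi i).sub (memLp_const _)
  have hmean : ∀ i, ∫ x : EuclideanSpace ℝ (Fin d), x i ∂ρ = m i := fun i ↦ by
    have h1 := (EuclideanSpace.proj (𝕜 := ℝ) i).integral_comp_comm
      (hL.integrable (by norm_num))
    have h2 : ∫ x, x ∂ρ = m := integral_id_multivariateGaussian
    rw [h2] at h1
    exact h1
  have hone : ∀ i, ∫ x : EuclideanSpace ℝ (Fin d), (x i - y i) ^ 2 ∂ρ = s + (m i - y i) ^ 2 := by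
    intro i
    have h1 := variance_eq_sub (hiy i)
    rw [variance_sub_const (hi i).aestronglyMeasurable, variance_eval_multivariateGaussian
      (posSemidef_smul_one hs), integral_sub ((hi i).integrable (by norm_num)) (integrable_const _),
      hmean] at h1
    simp only [Matrix.smul_apply, Matrix.one_apply_eq, smul_eq_mul, mul_one, integral_const,
      probReal_univ, one_mul, Pi.pow_apply] at h1
    linarith
  have e : ∀ x : EuclideanSpace ℝ (Fin d), ‖x - y‖ ^ 2 = ∑ i, (x i - y i) ^ 2 := fun x ↦ by
    rw [EuclideanSpace.real_norm_sq_eq]; simp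
  simp_rw [e]
  refine ⟨integrable_finsetSum _ fun i _ ↦ (hiy i).integrable_sq, ?_⟩
  rw [integral_finsetSum _ fun i _ ↦ (hiy i).integrable_sq]
  simp_rw [hone]
  rw [Finset.sum_add_distrib]
  simp [add_comm]

end GaussianLaw

/-! ### Riemann sums for the Wiener integral of an exponential -/

section RiemannSums

/-- Convergence of tagged Riemann sums with a continuous weight along uniform partitions. -/
lemma tendsto_tagged_riemann_sum {φ ψ : ℝ → ℝ} (hφ : Continuous φ) (hψ : Continuous ψ) {t : ℝ}
    (ht : 0 ≤ t) (ξ : ℕ → ℕ → ℝ)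
    (hξ : ∀ n k : ℕ, k < n + 1 →
      ξ n k ∈ Set.Icc (k * (t / (n + 1 : ℕ))) ((k + 1 : ℕ) * (t / (n + 1 : ℕ)))) :
    Filter.Tendsto (fun n : ℕ ↦ ∑ k ∈ Finset.range (n + 1),
      φ (ξ n k) * ∫ s in (k * (t / (n + 1 : ℕ)))..((k + 1 : ℕ) * (t / (n + 1 : ℕ))), ψ s)
      Filter.atTop (nhds (∫ s in (0 : ℝ)..t, φ s * ψ s)) := by
  obtain ⟨M, hM⟩ := (isCompact_Icc (a := (0 : ℝ)) (b := t)).exists_bound_of_continuousOn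
    hψ.continuousOn
  have hM0 : 0 ≤ M := (norm_nonneg _).trans (hM 0 ⟨le_rfl, ht⟩)
  have huc : UniformContinuousOn φ (Set.Icc 0 t) :=
    isCompact_Icc.uniformContinuousOn_of_continuous hφ.continuousOn
  rw [Metric.tendsto_atTop]
  intro ε hε
  obtain ⟨η, hη, hosc⟩ := Metric.uniformContinuousOn_iff.1 huc (ε / (M * t + 1)) (by positivity)
  obtain ⟨N, hN⟩ := exists_nat_gt (t / η)
  refine ⟨N, fun n hn ↦ ?_⟩
  set h : ℝ := t / (n + 1 : ℕ)
  have hn0 : (0 : ℝ) < (n + 1 : ℕ) := by positivity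
  have hh0 : 0 ≤ h := by positivity
  have hhη : h < η := by
    rw [div_lt_iff₀ hn0]
    rw [div_lt_iff₀ hη] at hN
    have : (N : ℝ) ≤ (n + 1 : ℕ) := by exact_mod_cast hn.trans (Nat.le_succ n)
    nlinarith
  have hnh : ((n + 1 : ℕ) : ℝ) * h = t := by simp only [h]; field_simp
  have hsplit : ∫ s in (0 : ℝ)..t, φ s * ψ s = ∑ k ∈ Finset.range (n + 1),
      ∫ s in (k * h)..((k + 1 : ℕ) * h), φ s * ψ s := by
    have := intervalIntegral.sum_integral_adjacent_intervals (μ := volume) (f := fun s ↦ φ s * ψ s)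
      (a := fun k : ℕ ↦ (k : ℝ) * h) (n := n + 1)
      (fun k _ ↦ (hφ.mul hψ).intervalIntegrable _ _)
    rw [this, hnh]; simp
  have hterm : ∀ k ∈ Finset.range (n + 1),
      ‖φ (ξ n k) * (∫ s in (k * h)..((k + 1 : ℕ) * h), ψ s)
        - ∫ s in (k * h)..((k + 1 : ℕ) * h), φ s * ψ s‖ ≤ ε / (M * t + 1) * M * h := by
    intro k hk
    rw [Finset.mem_range] at hk
    have hkh : (k : ℝ) * h ≤ (k + 1 : ℕ) * h := by gcongr; norm_num
    have hk1 : ((k + 1 : ℕ) : ℝ) * h ≤ t := by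
      rw [← hnh]; gcongr; omega
    have hk0 : 0 ≤ (k : ℝ) * h := by positivity
    rw [← intervalIntegral.integral_const_mul, ← intervalIntegral.integral_sub
      (f := fun s ↦ φ (ξ n k) * ψ s) (g := fun s ↦ φ s * ψ s)
      ((continuous_const.mul hψ).intervalIntegrable _ _) ((hφ.mul hψ).intervalIntegrable _ _)]
    have hb := intervalIntegral.norm_integral_le_of_norm_le_const
      (a := (k : ℝ) * h) (b := (k + 1 : ℕ) * h) (C := ε / (M * t + 1) * M)
      (f := fun s ↦ φ (ξ n k) * ψ s - φ s * ψ s) (fun s hs ↦ ?_)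
    · refine hb.trans_eq ?_
      rw [abs_of_nonneg (by linarith)]
      push_cast; ring
    · rw [Set.uIoc_of_le hkh] at hs
      have hsI : s ∈ Set.Icc 0 t := ⟨hk0.trans hs.1.le, hs.2.trans hk1⟩
      have hξI := hξ n k hk
      have hξI' : ξ n k ∈ Set.Icc 0 t := ⟨hk0.trans hξI.1, hξI.2.trans hk1⟩
      have hd : dist (ξ n k) s < η := by
        rw [Real.dist_eq, abs_lt]
        have e : ((k + 1 : ℕ) : ℝ) * h = k * h + h := by push_cast; ring
        rw [e] at hs hξI
        change ξ n k ∈ Set.Icc _ (k * h + h) at hξI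
        constructor <;> linarith [hs.1, hs.2, hξI.1, hξI.2]
      have ho := hosc _ hξI' _ hsI hd
      rw [← sub_mul, norm_mul]
      rw [dist_eq_norm] at ho
      exact mul_le_mul ho.le (hM s hsI) (norm_nonneg _) (by positivity)
  rw [dist_eq_norm, hsplit, ← Finset.sum_sub_distrib]
  calc _ ≤ ∑ k ∈ Finset.range (n + 1), ε / (M * t + 1) * M * h := norm_sum_le_of_le _ hterm
    _ = ε / (M * t + 1) * (M * t) := by
      rw [Finset.sum_const, Finset.card_range, nsmul_eq_mul, ← hnh]; ring
    _ < ε := by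
      rw [div_mul_eq_mul_div, div_lt_iff₀ (by positivity)]
      nlinarith

/-- The Riemann–Itô sum of `exp (s - t)` against the increments of `b` on `[0, t]`. -/
noncomputable def itoSum (t : ℝ≥0) (n : ℕ) (b : ℝ≥0 → ℝ) : ℝ :=
  ∑ k ∈ Finset.range (n + 1), Real.exp (k * ((t : ℝ) / (n + 1 : ℕ)) - t) *
    (b ((k + 1 : ℕ) * (t / (n + 1 : ℕ))) - b (k * (t / (n + 1 : ℕ))))

lemma measurable_itoSum (t : ℝ≥0) (n : ℕ) : Measurable (itoSum t n) := by
  unfold itoSum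
  fun_prop

lemma sum_mul_sub_eq_sub_sum (a b : ℕ → ℝ) (n : ℕ) :
    ∑ k ∈ Finset.range n, a k * (b (k + 1) - b k) =
      a n * b n - a 0 * b 0 - ∑ k ∈ Finset.range n, b (k + 1) * (a (k + 1) - a k) := by
  induction n with
  | zero => simp
  | succ n ih => rw [Finset.sum_range_succ, Finset.sum_range_succ, ih]; ring

/-- Summation by parts moves the differences from the rough path to the smooth exponential, so the
limit exists for every continuous path and no stochastic integral is needed. -/
lemma tendsto_itoSum (t : ℝ≥0) {b : ℝ≥0 → ℝ} (hb : Continuous b) (hb0 : b 0 = 0) :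
    Filter.Tendsto (fun n ↦ itoSum t n b) Filter.atTop
      (nhds (b t - ∫ s in (0 : ℝ)..t, Real.exp (s - t) * b s.toNNReal)) := by
  -- Tags at right endpoints, where summation by parts evaluates the path.
  have hR := tendsto_tagged_riemann_sum (φ := fun s ↦ b s.toNNReal) (ψ := fun s ↦ Real.exp (s - t))
    (hb.comp continuous_real_toNNReal) (by fun_prop) t.coe_nonneg
    (fun n k ↦ (k + 1 : ℕ) * ((t : ℝ) / (n + 1 : ℕ)))
    (fun n k _ ↦ ⟨mul_le_mul_of_nonneg_right (by norm_num) (by positivity), le_rfl⟩)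
  simp_rw [mul_comm (b _) (Real.exp _)] at hR
  refine (hR.const_sub (b t)).congr fun n ↦ ?_
  unfold itoSum
  set h : ℝ≥0 := t / (n + 1 : ℕ)
  have hh : (t : ℝ) / (n + 1 : ℕ) = (h : ℝ) := by simp [h]
  simp_rw [hh]
  have hnh : ((n + 1 : ℕ) : ℝ≥0) * h = t := by simp only [h]; field_simp
  have hnh' : ((n + 1 : ℕ) : ℝ) * h = t := by exact_mod_cast congrArg NNReal.toReal hnh
  have := sum_mul_sub_eq_sub_sum (fun k ↦ Real.exp (k * h - t)) (fun k ↦ b (k * h)) (n + 1)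
  rw [this, hnh, hnh']
  simp only [sub_self, Real.exp_zero, one_mul, Nat.cast_zero, zero_mul, hb0, mul_zero, sub_zero]
  congr 1
  refine Finset.sum_congr rfl fun k _ ↦ ?_
  have hF : ∫ s in (k * (h : ℝ))..((k + 1 : ℕ) * (h : ℝ)), Real.exp (s - t) =
      Real.exp ((k + 1 : ℕ) * h - t) - Real.exp (k * h - t) := by
    refine intervalIntegral.integral_eq_sub_of_hasDerivAt (f := fun s ↦ Real.exp (s - t))
      (fun s _ ↦ ?_) (Continuous.intervalIntegrable (by fun_prop) _ _)
    simpa using ((hasDerivAt_id s).sub_const (t : ℝ)).exp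
  rw [hF]
  congr 2
  rw [← NNReal.coe_natCast, ← NNReal.coe_mul, Real.toNNReal_coe]

/-- The variance of `itoSum t n` along a Brownian motion. -/
noncomputable def itoVariance (t : ℝ) (n : ℕ) : ℝ :=
  ∑ k ∈ Finset.range (n + 1), Real.exp (2 * (k * (t / (n + 1 : ℕ)) - t)) * (t / (n + 1 : ℕ))

lemma tendsto_itoVariance {t : ℝ} (ht : 0 ≤ t) :
    Filter.Tendsto (itoVariance t) Filter.atTop (nhds ((1 - Real.exp (-2 * t)) / 2)) := by
  have hR := tendsto_tagged_riemann_sum (φ := fun s ↦ Real.exp (2 * (s - t))) (ψ := fun _ ↦ 1)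
    (by fun_prop) (by fun_prop) ht (fun n k ↦ k * (t / (n + 1 : ℕ))) (fun n k _ ↦ ⟨le_rfl, by
      gcongr; norm_num⟩)
  have hF : ∫ s in (0 : ℝ)..t, Real.exp (2 * (s - t)) * 1 = (1 - Real.exp (-2 * t)) / 2 := by
    simp_rw [mul_one]
    have := intervalIntegral.integral_eq_sub_of_hasDerivAt (a := 0) (b := t)
      (f := fun s ↦ Real.exp (2 * (s - t)) / 2) (f' := fun s ↦ Real.exp (2 * (s - t)))
      (fun s _ ↦ ?_) (Continuous.intervalIntegrable (by fun_prop) _ _)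
    · rw [this]
      simp only [sub_self, mul_zero, Real.exp_zero, zero_sub]
      ring_nf
    · have := ((((hasDerivAt_id s).sub_const t).const_mul 2).exp).div_const 2
      refine this.congr_deriv ?_
      simp
  rw [hF] at hR
  refine hR.congr fun n ↦ ?_
  refine Finset.sum_congr rfl fun k _ ↦ ?_
  congr 1
  rw [intervalIntegral.integral_const]
  push_cast
  simp only [smul_eq_mul]
  ring

lemma charFun_itoSum {Ω : Type*} [MeasurableSpace Ω] {P : Measure Ω} {b : ℝ≥0 → Ω → ℝ}
    (hb : IsPreBrownianReal b P) (t : ℝ≥0) (n : ℕ) (u : ℝ) :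
    charFun (P.map fun ω ↦ itoSum t n (fun s ↦ b s ω)) u =
      Complex.exp (-(itoVariance t n * u ^ 2 / 2 : ℝ)) := by
  have := hb.isGaussianProcess.isProbabilityMeasure
  set h : ℝ≥0 := t / (n + 1 : ℕ)
  have hh : (t : ℝ) / (n + 1 : ℕ) = (h : ℝ) := by simp [h]
  have hind := hb.hasIndepIncrements.nat (t := fun k : ℕ ↦ (k : ℝ≥0) * h) (fun i j hij ↦ by
    simp only; gcongr)
  have hind2 := hind.comp (fun k x ↦ Real.exp (k * (h : ℝ) - t) * x) (fun k ↦ by fun_prop)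
  have hm : ∀ k : ℕ, AEMeasurable (fun ω ↦ b ((k + 1 : ℕ) * h) ω - b (k * h) ω) P := fun k ↦
    (hb.aemeasurable _).sub (hb.aemeasurable _)
  have key := iIndepFun.charFun_map_fun_finsetSum_eq_prod (s := Finset.range (n + 1))
    (fun k _ ↦ (hm k).const_mul (Real.exp (k * (h : ℝ) - t))) (hind2.restrict _)
  unfold itoSum itoVariance
  simp_rw [hh]
  rw [key, Finset.prod_apply]
  have hone : ∀ k ∈ Finset.range (n + 1),
      charFun (P.map fun ω ↦ Real.exp (k * (h : ℝ) - t) * (b ((k + 1 : ℕ) * h) ω - b (k * h) ω)) u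
      = Complex.exp (-(Real.exp (2 * (k * (h : ℝ) - t)) * h * u ^ 2 / 2 : ℝ)) := by
    intro k _
    rw [charFun_map_mul_comp (hm k)]
    have hl := (hb.hasLaw_sub ((k + 1 : ℕ) * h) (k * h)).map_eq
    change P.map (fun ω ↦ b ((k + 1 : ℕ) * h) ω - b (k * h) ω) = _ at hl
    rw [hl, charFun_gaussianReal]
    have hv : ((nndist (((k + 1 : ℕ) * h : ℝ≥0) : ℝ) ((k * h : ℝ≥0) : ℝ) : ℝ≥0) : ℝ) = h := by
      rw [coe_nndist, Real.dist_eq]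
      push_cast
      rw [show ((k : ℝ) + 1) * h - k * h = h by ring]
      exact abs_of_nonneg h.2
    have hv' : ((((nndist (((k + 1 : ℕ) * h : ℝ≥0) : ℝ) ((k * h : ℝ≥0) : ℝ) : ℝ≥0) : ℝ)) : ℂ)
      = (h : ℝ) := by rw [hv]
    have e : (2 : ℝ) * (k * (h : ℝ) - t) = (k * (h : ℝ) - t) + (k * (h : ℝ) - t) := by ring
    rw [e, Real.exp_add]
    congr 1
    erw [hv']
    push_cast
    ring
  rw [Finset.prod_congr rfl hone, ← Complex.exp_sum]
  congr 1
  push_cast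
  rw [Finset.sum_neg_distrib, Finset.sum_mul, Finset.sum_div]

end RiemannSums

/-! ### Gaussian law of the variation-of-constants formula -/

section OrnsteinUhlenbeck

variable {d : ℕ} {Ω : Type*} [MeasurableSpace Ω] {P : Measure Ω}
  {B : ℝ≥0 → Ω → EuclideanSpace ℝ (Fin d)}

lemma IsBrownianMotion.ae_continuous (hB : IsBrownianMotion B P) :
    ∀ᵐ ω ∂P, Continuous fun t ↦ B t ω := by
  have h : ∀ᵐ ω ∂P, ∀ i, Continuous fun t ↦ B t ω i :=
    ae_all_iff.2 fun i ↦ (hB.brownian_coord i).cont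
  filter_upwards [h] with ω hω
  have : Continuous fun t ↦ WithLp.toLp 2 (fun i ↦ B t ω i) :=
    (PiLp.continuous_toLp 2 _).comp (continuous_pi hω)
  exact this

lemma IsBrownianMotion.ae_zero (hB : IsBrownianMotion B P) : ∀ᵐ ω ∂P, B 0 ω = 0 := by
  have h : ∀ᵐ ω ∂P, ∀ i, B 0 ω i = 0 :=
    ae_all_iff.2 fun i ↦ (hB.brownian_coord i).eval_zero_ae_eq_zero
  filter_upwards [h] with ω hω
  ext i
  exact hω i

/-- The vector of Riemann–Itô sums of the coordinates. -/
noncomputable def itoSumVec (t : ℝ≥0) (n : ℕ) (b : ℝ≥0 → EuclideanSpace ℝ (Fin d)) :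
    EuclideanSpace ℝ (Fin d) :=
  WithLp.toLp 2 fun i ↦ itoSum t n fun s ↦ b s i

lemma measurable_itoSumVec (t : ℝ≥0) (n : ℕ) : Measurable (itoSumVec (d := d) t n) := by
  unfold itoSumVec
  refine (WithLp.measurable_toLp 2 _).comp (measurable_pi_lambda _ fun i ↦ ?_)
  refine (measurable_itoSum t n).comp (measurable_pi_lambda _ fun s ↦ ?_)
  have h1 : Measurable fun x : EuclideanSpace ℝ (Fin d) ↦ x i := by fun_prop
  exact h1.comp (measurable_pi_apply s)

lemma charFun_itoSumVec [IsProbabilityMeasure P] (hB : IsBrownianMotion B P) (t : ℝ≥0) (n : ℕ)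
    (ξ : EuclideanSpace ℝ (Fin d)) :
    charFun (P.map fun ω ↦ itoSumVec t n (fun s ↦ B s ω)) ξ =
      Complex.exp (-(itoVariance t n * ‖ξ‖ ^ 2 / 2 : ℝ)) := by
  have hm : ∀ i, Measurable fun ω ↦ itoSum t n (fun s ↦ B s ω i) := fun i ↦
    (measurable_itoSum t n).comp (measurable_pi_lambda _ fun s ↦ by
      have := hB.measurable s
      fun_prop)
  have hind : iIndepFun (fun i ω ↦ itoSum t n (fun s ↦ B s ω i)) P :=
    hB.indep_coord.comp (fun _ ↦ itoSum t n) fun _ ↦ measurable_itoSum t n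
  have h := (iIndepFun_iff_charFun_pi (fun i ↦ (hm i).aemeasurable)).1 hind ξ
  unfold itoSumVec
  rw [h]
  simp_rw [fun i ↦ charFun_itoSum (hB.brownian_coord i).toIsPreBrownianReal t n (ξ i)]
  rw [← Complex.exp_sum, EuclideanSpace.real_norm_sq_eq]
  congr 1
  push_cast
  rw [Finset.sum_neg_distrib, Finset.mul_sum, Finset.sum_div]

lemma tendsto_itoSumVec (t : ℝ≥0) {b : ℝ≥0 → EuclideanSpace ℝ (Fin d)} (hb : Continuous b)
    (hb0 : b 0 = 0) :
    Filter.Tendsto (fun n ↦ itoSumVec t n b) Filter.atTop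
      (nhds (b t - ∫ s in (0 : ℝ)..t, Real.exp (s - t) • b s.toNNReal)) := by
  have hcoord : ∀ i, Continuous fun s ↦ b s i := fun i ↦
    (EuclideanSpace.proj (𝕜 := ℝ) i).continuous.comp hb
  have h : Filter.Tendsto (fun n i ↦ itoSum t n fun s ↦ b s i) Filter.atTop
      (nhds fun i ↦ (b t - ∫ s in (0 : ℝ)..t, Real.exp (s - t) • b s.toNNReal) i) := by
    refine tendsto_pi_nhds.2 fun i ↦ ?_
    have h1 := tendsto_itoSum t (hcoord i) (by simp [hb0])
    have hi : IntervalIntegrable (fun s : ℝ ↦ Real.exp (s - t) • b s.toNNReal) volume 0 t := by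
      refine Continuous.intervalIntegrable ?_ _ _
      exact (Real.continuous_exp.comp (continuous_id.sub continuous_const)).smul
        (hb.comp continuous_real_toNNReal)
    have h2 := (EuclideanSpace.proj (𝕜 := ℝ) i).intervalIntegral_comp_comm hi
    simp only [map_smul, smul_eq_mul] at h2
    have h3 : (b t - ∫ s in (0 : ℝ)..t, Real.exp (s - t) • b s.toNNReal) i =
        b t i - ∫ s in (0 : ℝ)..t, Real.exp (s - t) * b s.toNNReal i := by
      rw [PiLp.sub_apply]
      congr 1
      exact h2.symm
    rw [h3]
    exact h1
  exact ((PiLp.continuous_toLp 2 _).tendsto _).comp h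

/-- An affine combination of an isotropic Gaussian vector and an independent exponential Wiener
integral is an isotropic Gaussian vector. -/
lemma map_eq_isotropicGaussian [IsProbabilityMeasure P] (hB : IsBrownianMotion B P)
    {X₀ Y : Ω → EuclideanSpace ℝ (Fin d)} (hX₀ : Measurable X₀) (hY : Measurable Y)
    {m₀ : EuclideanSpace ℝ (Fin d)} {s₀ : ℝ} (hs₀ : 0 ≤ s₀)
    (hlaw : P.map X₀ = multivariateGaussian m₀ (s₀ • (1 : Matrix (Fin d) (Fin d) ℝ)))
    (hind : IndepFun X₀ (fun ω (t : ℝ≥0) ↦ B t ω) P) (t : ℝ≥0) (r c : ℝ)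
    (a : EuclideanSpace ℝ (Fin d))
    (hYeq : ∀ᵐ ω ∂P, Y ω = r • X₀ ω + (a +
      c • (B t ω - ∫ s in (0 : ℝ)..t, Real.exp (s - t) • B s.toNNReal ω))) :
    P.map Y = multivariateGaussian (r • m₀ + a)
      ((r ^ 2 * s₀ + c ^ 2 * ((1 - Real.exp (-2 * t)) / 2)) • (1 : Matrix (Fin d) (Fin d) ℝ)) := by
  have hv : 0 ≤ r ^ 2 * s₀ + c ^ 2 * ((1 - Real.exp (-2 * (t : ℝ))) / 2) := by
    have : Real.exp (-2 * (t : ℝ)) ≤ 1 := Real.exp_le_one_iff.2 (by simp)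
    have : 0 ≤ 1 - Real.exp (-2 * (t : ℝ)) := by linarith
    positivity
  have := Measure.isProbabilityMeasure_map (μ := P) hY.aemeasurable
  refine Measure.ext_of_charFun (funext fun ξ ↦ ?_)
  have hBm : Measurable fun ω (t : ℝ≥0) ↦ B t ω := measurable_pi_lambda _ hB.measurable
  have hZm : ∀ n, Measurable fun ω ↦ itoSumVec t n (fun s ↦ B s ω) := fun n ↦
    (measurable_itoSumVec t n).comp hBm
  set Yn : ℕ → Ω → EuclideanSpace ℝ (Fin d) :=
    fun n ω ↦ r • X₀ ω + (a + c • itoSumVec t n (fun s ↦ B s ω))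
  have hYnm : ∀ n, Measurable (Yn n) := fun n ↦ by
    have := hZm n
    fun_prop
  -- The integrands have modulus one, so almost sure convergence of the Riemann sums passes to
  -- characteristic functions by dominated convergence.
  have hlim : Filter.Tendsto (fun n ↦ charFun (P.map (Yn n)) ξ) Filter.atTop
      (nhds (charFun (P.map Y) ξ)) := by
    have hcont : Continuous fun x : EuclideanSpace ℝ (Fin d) ↦
        Complex.exp (inner ℝ x ξ * Complex.I) := by fun_prop
    simp_rw [charFun_apply]
    rw [integral_map hY.aemeasurable hcont.aestronglyMeasurable]
    simp_rw [fun n ↦ integral_map (hYnm n).aemeasurable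
      (hcont.aestronglyMeasurable (μ := P.map (Yn n)))]
    refine tendsto_integral_of_dominated_convergence (fun _ ↦ 1)
      (fun n ↦ (hcont.measurable.comp (hYnm n)).aestronglyMeasurable) (integrable_const _)
      (fun n ↦ .of_forall fun ω ↦ (Complex.norm_exp_ofReal_mul_I _).le) ?_
    filter_upwards [hYeq, hB.ae_continuous, hB.ae_zero] with ω h1 h2 h3
    refine (hcont.tendsto _).comp ?_
    rw [h1]
    exact (((tendsto_itoSumVec t h2 h3).const_smul c).const_add a).const_add _
  have hval : ∀ n, charFun (P.map (Yn n)) ξ = Complex.exp (inner ℝ ξ (r • m₀ + a) * Complex.I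
      - (((r ^ 2 * s₀ + c ^ 2 * itoVariance t n) * ‖ξ‖ ^ 2 : ℝ)) / 2) := by
    intro n
    have hcZ : Measurable fun ω ↦ c • itoSumVec t n (fun s ↦ B s ω) := (hZm n).const_smul c
    have haZ : Measurable fun ω ↦ a + c • itoSumVec t n (fun s ↦ B s ω) := hcZ.const_add a
    have hi : IndepFun (fun ω ↦ r • X₀ ω)
        (fun ω ↦ a + c • itoSumVec t n (fun s ↦ B s ω)) P :=
      hind.comp (φ := fun x ↦ r • x) (ψ := fun b ↦ a + c • itoSumVec t n b) (by fun_prop)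
        (((measurable_itoSumVec t n).const_smul c).const_add a)
    have h1 := hi.charFun_map_fun_add_eq_mul (by fun_prop)
      haZ.aemeasurable
    have h2 : P.map (fun ω ↦ a + c • itoSumVec t n (fun s ↦ B s ω)) =
        (P.map (fun ω ↦ c • itoSumVec t n (fun s ↦ B s ω))).map (fun x ↦ a + x) := by
      rw [Measure.map_map (by fun_prop) hcZ]
      rfl
    change charFun (P.map fun ω ↦ r • X₀ ω + (a + c • itoSumVec t n (fun s ↦ B s ω))) ξ = _
    rw [h1, Pi.mul_apply, charFun_map_smul_comp hX₀.aemeasurable, hlaw,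
      charFun_isotropicGaussian m₀ hs₀, h2, charFun_map_const_add,
      charFun_map_smul_comp (hZm n).aemeasurable, charFun_itoSumVec hB, ← Complex.exp_add,
      ← Complex.exp_add]
    congr 1
    rw [norm_smul, norm_smul, mul_pow, mul_pow, Real.norm_eq_abs, Real.norm_eq_abs, sq_abs, sq_abs,
      inner_add_right, inner_smul_left, inner_smul_right, real_inner_comm a ξ]
    simp only [conj_trivial]
    push_cast
    ring
  have hlim2 : Filter.Tendsto (fun n ↦ charFun (P.map (Yn n)) ξ) Filter.atTop
      (nhds (Complex.exp (inner ℝ ξ (r • m₀ + a) * Complex.I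
      - (((r ^ 2 * s₀ + c ^ 2 * ((1 - Real.exp (-2 * (t : ℝ))) / 2)) * ‖ξ‖ ^ 2 : ℝ)) / 2))) := by
    simp_rw [hval]
    have hc : Continuous fun v : ℝ ↦ Complex.exp (inner ℝ ξ (r • m₀ + a) * Complex.I
      - (((r ^ 2 * s₀ + c ^ 2 * v) * ‖ξ‖ ^ 2 : ℝ)) / 2) := by fun_prop
    exact (hc.tendsto _).comp (tendsto_itoVariance t.coe_nonneg)
  rw [charFun_isotropicGaussian _ hv]
  exact tendsto_nhds_unique hlim hlim2

end OrnsteinUhlenbeck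

/-! ### The clipping map -/

section Clip

variable {d : ℕ}

/-- A form whose denominator never vanishes, from which continuity at `0` is visible. -/
lemma clip_eq {R : ℝ} (hR : 0 < R) (x : EuclideanSpace ℝ (Fin d)) :
    clip R x = (R / max R ‖x‖) • x := by
  unfold clip
  rcases eq_or_ne x 0 with rfl | hx
  · simp
  · have hx' : 0 < ‖x‖ := norm_pos_iff.2 hx
    rcases le_total R ‖x‖ with h | h
    · rw [min_eq_left h, max_eq_right h]
    · rw [min_eq_right h, max_eq_left h, div_self hx'.ne', div_self hR.ne']

lemma continuous_clip {R : ℝ} (hR : 0 < R) :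
    Continuous (clip R : EuclideanSpace ℝ (Fin d) → EuclideanSpace ℝ (Fin d)) := by
  rw [funext (clip_eq hR)]
  have : ∀ x : EuclideanSpace ℝ (Fin d), max R ‖x‖ ≠ 0 := fun x ↦
    (hR.trans_le (le_max_left _ _)).ne'
  fun_prop (disch := assumption)

lemma norm_clip_le {R : ℝ} (hR : 0 < R) (x : EuclideanSpace ℝ (Fin d)) : ‖clip R x‖ ≤ R := by
  have hpos : 0 < max R ‖x‖ := hR.trans_le (le_max_left _ _)
  rw [clip_eq hR, norm_smul, Real.norm_of_nonneg (by positivity), div_mul_eq_mul_div,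
    div_le_iff₀ hpos]
  gcongr
  exact le_max_right _ _

/-- With `l = R / ‖x‖ ≤ 1`, the difference of the squared norms is `(1 - l) (‖x‖ (‖x‖ - R) + 2 (R
‖x‖ - ⟪x, y⟫))`, and both summands are nonnegative. -/
lemma norm_clip_sub_le {R : ℝ} (hR : 0 < R) (x : EuclideanSpace ℝ (Fin d))
    {y : EuclideanSpace ℝ (Fin d)} (hy : ‖y‖ ≤ R) : ‖clip R x - y‖ ≤ ‖x - y‖ := by
  rw [clip_eq hR]
  rcases le_total ‖x‖ R with h | h
  · rw [max_eq_left h, div_self hR.ne', one_smul]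
  · rw [max_eq_right h]
    have hx : 0 < ‖x‖ := hR.trans_le h
    set l := R / ‖x‖
    have hl0 : 0 < l := by positivity
    have hl1 : l ≤ 1 := (div_le_one hx).2 h
    have hlR : l * ‖x‖ = R := by simp only [l]; field_simp
    have hin := real_inner_le_norm x y
    refine le_of_sq_le_sq ?_ (norm_nonneg _)
    rw [norm_sub_sq_real, norm_sub_sq_real, norm_smul, Real.norm_of_nonneg hl0.le, inner_smul_left]
    simp only [conj_trivial]
    have h1 : inner ℝ x y ≤ ‖x‖ * R := hin.trans (by gcongr)
    have h2 : 0 ≤ (1 - l) * (‖x‖ * R - inner ℝ x y) :=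
      mul_nonneg (by linarith) (by linarith)
    have h3 : 0 ≤ (1 - l) * (‖x‖ * (‖x‖ - R)) :=
      mul_nonneg (by linarith) (mul_nonneg hx.le (by linarith))
    nlinarith

end Clip

/-! ### From the McKean–Vlasov equation to an ODE for the mean -/

section Solution

variable {d : ℕ} {Ω : Type*} [MeasurableSpace Ω] {P : Measure Ω} [IsProbabilityMeasure P]
  {f : EuclideanSpace ℝ (Fin d) → ℝ} {X : ℝ≥0 → Ω → EuclideanSpace ℝ (Fin d)}

lemma continuous_integral_comp {F : Type*} [NormedAddCommGroup F] [NormedSpace ℝ F]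
    (hX : ∀ t, Measurable (X t)) (hXc : ∀ᵐ ω ∂P, Continuous fun t ↦ X t ω)
    {φ : EuclideanSpace ℝ (Fin d) → F} (hφ : Continuous φ) {C : ℝ} (hC : ∀ x, ‖φ x‖ ≤ C) :
    Continuous fun t ↦ ∫ x, φ x ∂(P.map (X t)) := by
  simp_rw [fun t ↦ integral_map (hX t).aemeasurable
    (hφ.aestronglyMeasurable (μ := P.map (X t)))]
  refine continuous_of_dominated (bound := fun _ ↦ C)
    (fun t ↦ hφ.aestronglyMeasurable.comp_measurable (hX t))
    (fun t ↦ .of_forall fun ω ↦ hC _) (integrable_const _) ?_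
  filter_upwards [hXc] with ω hω using hφ.comp hω

/-- Makes the drift continuous in time. Linear growth of `f` bounds both `exp (-α f)` and `exp (-α
f) • x`, so path continuity suffices and no moments of the law are needed. -/
lemma continuous_consensusPoint {xs : EuclideanSpace ℝ (Fin d)} {κ α : ℝ} (hκ : 0 < κ) (hα : 0 < α)
    (hf : Continuous f) (hgr : ∀ x, f xs + κ / 2 * (‖x - xs‖ - 1) ≤ f x)
    (hX : ∀ t, Measurable (X t)) (hXc : ∀ᵐ ω ∂P, Continuous fun t ↦ X t ω) :
    Continuous fun t ↦ consensusPoint f α (P.map (X t)) := by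
  set q := α * κ / 2
  have hq : 0 < q := by positivity
  set A := Real.exp (-α * f xs + q)
  have hw : ∀ x, Real.exp (-α * f x) ≤ A * Real.exp (-(q * ‖x - xs‖)) := fun x ↦ by
    rw [← Real.exp_add, Real.exp_le_exp]
    have := mul_le_mul_of_nonneg_left (hgr x) hα.le
    simp only [q]
    linarith
  have hb1 : ∀ x, ‖Real.exp (-α * f x)‖ ≤ A := fun x ↦ by
    rw [Real.norm_of_nonneg (Real.exp_pos _).le]
    refine (hw x).trans (mul_le_of_le_one_right (Real.exp_pos _).le (Real.exp_le_one_iff.2 ?_))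
    have : 0 ≤ q * ‖x - xs‖ := by positivity
    linarith
  have hb2 : ∀ x, ‖Real.exp (-α * f x) • x‖ ≤ A * (q⁻¹ + ‖xs‖) := fun x ↦ by
    rw [norm_smul, Real.norm_of_nonneg (Real.exp_pos _).le]
    have h1 : ‖x‖ ≤ ‖x - xs‖ + ‖xs‖ := by simpa using norm_add_le (x - xs) xs
    have h2 : Real.exp (-(q * ‖x - xs‖)) * ‖x - xs‖ ≤ q⁻¹ := by
      rw [Real.exp_neg, inv_mul_le_iff₀ (Real.exp_pos _), ← div_eq_mul_inv, le_div_iff₀ hq]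
      linarith [Real.add_one_le_exp (q * ‖x - xs‖)]
    have h3 : Real.exp (-(q * ‖x - xs‖)) * ‖xs‖ ≤ ‖xs‖ := by
      refine mul_le_of_le_one_left (norm_nonneg _) (Real.exp_le_one_iff.2 ?_)
      have : 0 ≤ q * ‖x - xs‖ := by positivity
      linarith
    calc _ ≤ A * Real.exp (-(q * ‖x - xs‖)) * (‖x - xs‖ + ‖xs‖) := by
          gcongr
          exact hw x
      _ = A * (Real.exp (-(q * ‖x - xs‖)) * ‖x - xs‖ + Real.exp (-(q * ‖x - xs‖)) * ‖xs‖) := by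
          ring
      _ ≤ _ := by gcongr
  have hc1 : Continuous fun x ↦ Real.exp (-α * f x) := by fun_prop
  have hc2 : Continuous fun x ↦ Real.exp (-α * f x) • x := by fun_prop
  unfold consensusPoint
  refine ((continuous_integral_comp hX hXc hc1 hb1).inv₀ fun t ↦ ?_).smul
    (continuous_integral_comp hX hXc hc2 hb2)
  have := Measure.isProbabilityMeasure_map (μ := P) (hX t).aemeasurable
  exact (integral_exp_pos (Integrable.of_bound hc1.aestronglyMeasurable A (.of_forall hb1))).ne'

/-- Variation of constants for `x' = c - x + w'`. -/
lemma variation_of_constants {E : Type*} [NormedAddCommGroup E] [NormedSpace ℝ E] [CompleteSpace E]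
    {x c w : ℝ → E} (hx : Continuous x) (hc : Continuous c) (hw : Continuous w) {x₀ : E}
    (heq : ∀ t, 0 ≤ t → x t = x₀ + (∫ s in (0 : ℝ)..t, (c s - x s)) + w t) {t : ℝ} (ht : 0 ≤ t) :
    x t = Real.exp (-t) • x₀ + (Real.exp (-t) • (∫ s in (0 : ℝ)..t, Real.exp s • c s)
      + (w t - ∫ s in (0 : ℝ)..t, Real.exp (s - t) • w s)) := by
  -- The path `x` need not be differentiable, but `V`, which is `x - w` for nonnegative times, is.
  set V : ℝ → E := fun t ↦ x₀ + ∫ s in (0 : ℝ)..t, (c s - x s)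
  have hV : ∀ s, HasDerivAt V (c s - x s) s := fun s ↦
    ((hc.sub hx).integral_hasStrictDerivAt 0 s).hasDerivAt.const_add x₀
  have hder : ∀ s ∈ Set.uIcc 0 t, HasDerivAt (fun s ↦ Real.exp s • V s)
      (Real.exp s • c s - Real.exp s • w s) s := by
    intro s hs
    rw [Set.uIcc_of_le ht] at hs
    refine ((Real.hasDerivAt_exp s).smul (hV s)).congr_deriv ?_
    have : x s = V s + w s := heq s hs.1
    rw [this]
    module
  have i1 : IntervalIntegrable (fun s ↦ Real.exp s • c s) volume 0 t :=
    (Real.continuous_exp.smul hc).intervalIntegrable _ _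
  have i2 : IntervalIntegrable (fun s ↦ Real.exp s • w s) volume 0 t :=
    (Real.continuous_exp.smul hw).intervalIntegrable _ _
  have hint := intervalIntegral.integral_eq_sub_of_hasDerivAt hder (i1.sub i2)
  rw [intervalIntegral.integral_sub i1 i2] at hint
  have hV0 : V 0 = x₀ := by simp [V]
  rw [hV0, Real.exp_zero, one_smul] at hint
  have e : ∫ s in (0 : ℝ)..t, Real.exp (s - t) • w s =
      Real.exp (-t) • ∫ s in (0 : ℝ)..t, Real.exp s • w s := by
    rw [← intervalIntegral.integral_smul]
    congr 1 with s
    rw [smul_smul, ← Real.exp_add, neg_add_eq_sub]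
  have hVt : V t = Real.exp (-t) • (Real.exp t • V t) := by
    rw [smul_smul, ← Real.exp_add]; simp
  have hxt : x t = V t + w t := heq t ht
  have h2 : Real.exp t • V t = x₀ + ((∫ s in (0 : ℝ)..t, Real.exp s • c s) -
      ∫ s in (0 : ℝ)..t, Real.exp s • w s) := by
    rw [hint]; abel
  rw [e, hxt, hVt, h2]
  module

/-- The solution of `m' = c - m` with initial value `m₀`. -/
noncomputable def relaxationPath {E : Type*} [NormedAddCommGroup E] [NormedSpace ℝ E]
    (m₀ : E) (c : ℝ → E) (t : ℝ) : E :=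
  Real.exp (-t) • (m₀ + ∫ s in (0 : ℝ)..t, Real.exp s • c s)

lemma hasDerivAt_relaxationPath {E : Type*} [NormedAddCommGroup E] [NormedSpace ℝ E]
    [CompleteSpace E] (m₀ : E) {c : ℝ → E} (hc : Continuous c) (t : ℝ) :
    HasDerivAt (relaxationPath m₀ c) (c t - relaxationPath m₀ c t) t := by
  have h1 : HasDerivAt (fun t ↦ m₀ + ∫ s in (0 : ℝ)..t, Real.exp s • c s) (Real.exp t • c t) t :=
    ((Real.continuous_exp.smul hc).integral_hasStrictDerivAt 0 t).hasDerivAt.const_add m₀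
  have h2 : HasDerivAt (fun t : ℝ ↦ Real.exp (-t)) (-Real.exp (-t)) t := by
    simpa using (hasDerivAt_neg t).exp
  refine (h2.smul h1).congr_deriv ?_
  rw [smul_smul, ← Real.exp_add]
  simp only [neg_add_cancel, Real.exp_zero, relaxationPath]
  module

/-- The law of a solution is an isotropic Gaussian whose mean relaxes to the consensus point. -/
lemma IsClippedSolution.map_eq {B : ℝ≥0 → Ω → EuclideanSpace ℝ (Fin d)}
    {xs m₀ : EuclideanSpace ℝ (Fin d)} {κ α γ R s₀ : ℝ} (hκ : 0 < κ) (hα : 0 < α) (hγ : 0 < γ)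
    (hR : 0 < R) (hs₀ : 0 ≤ s₀)
    (hf : Continuous f) (hgr : ∀ x, f xs + κ / 2 * (‖x - xs‖ - 1) ≤ f x)
    (hsol : IsClippedSolution P f α γ R
      (multivariateGaussian m₀ (s₀ • (1 : Matrix (Fin d) (Fin d) ℝ))) B X) :
    Continuous (fun s : ℝ ↦ clip R (consensusPoint f α (P.map (X s.toNNReal)))) ∧
    ∀ t : ℝ≥0, P.map (X t) = multivariateGaussian
      (relaxationPath m₀ (fun s ↦ clip R (consensusPoint f α (P.map (X s.toNNReal)))) t)
      ((Real.exp (-2 * t) * s₀ + γ / α * (1 - Real.exp (-2 * t))) •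
        (1 : Matrix (Fin d) (Fin d) ℝ)) := by
  have hc : Continuous (fun s : ℝ ↦ clip R (consensusPoint f α (P.map (X s.toNNReal)))) :=
    (continuous_clip hR).comp ((continuous_consensusPoint hκ hα hf hgr hsol.measurable
      hsol.continuous_paths).comp continuous_real_toNNReal)
  refine ⟨hc, fun t ↦ ?_⟩
  set c : ℝ → EuclideanSpace ℝ (Fin d) :=
    fun s : ℝ ↦ clip R (consensusPoint f α (P.map (X s.toNNReal)))
  have h := map_eq_isotropicGaussian hsol.brownian (hsol.measurable 0) (hsol.measurable t) hs₀
    hsol.initial_law.map_eq hsol.indep t (Real.exp (-t)) (√(2 * γ / α))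
    (Real.exp (-t) • ∫ s in (0 : ℝ)..t, Real.exp s • c s) (by
      filter_upwards [hsol.continuous_paths, hsol.equation, hsol.brownian.ae_continuous]
        with ω h1 h2 h3
      have h4 : Continuous fun s : ℝ ↦ B s.toNNReal ω := h3.comp continuous_real_toNNReal
      have hv := variation_of_constants (x := fun s ↦ X s.toNNReal ω) (c := c)
        (w := fun s ↦ √(2 * γ / α) • B s.toNNReal ω) (x₀ := X 0 ω)
        (h1.comp continuous_real_toNNReal) hc (by fun_prop)
        (fun s hs ↦ by
          have := h2 s.toNNReal
          rw [Real.coe_toNNReal s hs] at this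
          exact this) t.coe_nonneg
      simp only [Real.toNNReal_coe] at hv
      rw [hv]
      congr 2
      rw [smul_sub, ← intervalIntegral.integral_smul]
      congr 2 with s
      rw [smul_comm])
  rw [h]
  congr 1
  · rw [relaxationPath, smul_add]
  · congr 1
    rw [Real.sq_sqrt (by positivity), ← Real.exp_nat_mul]
    push_cast
    ring_nf

end Solution

/-! ### Differential inequalities for the distance to the minimizer -/

section Comparison

/-- Grönwall's inequality: adding `e / K` makes it homogeneous. Both signs of `K` occur, growth
before the initial time and decay after it. -/
lemma le_exp_mul_of_deriv_le {p p' : ℝ → ℝ} {a b K e : ℝ} (hab : a ≤ b) (hK : K ≠ 0)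
    (hp : ∀ t, HasDerivAt p (p' t) t) (hle : ∀ t ∈ Set.Ioo a b, p' t ≤ K * p t + e) :
    p b + e / K ≤ Real.exp (K * (b - a)) * (p a + e / K) := by
  set h : ℝ → ℝ := fun t ↦ Real.exp (-K * t) * (p t + e / K)
  have hh : ∀ t, HasDerivAt h (Real.exp (-K * t) * (p' t - (K * p t + e))) t := fun t ↦ by
    have h1 : HasDerivAt (fun t : ℝ ↦ Real.exp (-K * t)) (Real.exp (-K * t) * -K) t := by
      simpa using ((hasDerivAt_id t).const_mul (-K)).exp
    refine (h1.mul ((hp t).add_const (e / K))).congr_deriv ?_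
    field_simp
    ring
  have hanti : AntitoneOn h (Set.Icc a b) := by
    refine antitoneOn_of_deriv_nonpos (convex_Icc a b)
      (fun t _ ↦ (hh t).continuousAt.continuousWithinAt)
      (fun t _ ↦ (hh t).differentiableAt.differentiableWithinAt) fun t ht ↦ ?_
    rw [interior_Icc] at ht
    rw [(hh t).deriv]
    exact mul_nonpos_of_nonneg_of_nonpos (Real.exp_pos _).le (by linarith [hle t ht])
  have h1 := hanti (Set.left_mem_Icc.2 hab) (Set.right_mem_Icc.2 hab) hab
  have h2 := mul_le_mul_of_nonneg_left h1 (Real.exp_pos (K * b)).le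
  simp only [h] at h2
  rw [← mul_assoc, ← mul_assoc, ← Real.exp_add, ← Real.exp_add] at h2
  rw [show K * b + -K * b = 0 by ring, Real.exp_zero, one_mul,
    show K * b + -K * a = K * (b - a) by ring] at h2
  exact h2

variable {E : Type*} [NormedAddCommGroup E] [InnerProductSpace ℝ E] {v g : ℝ → E}

lemma hasDerivAt_norm_sq_relaxation (hv : ∀ t, HasDerivAt v (g t - v t) t) (t : ℝ) :
    HasDerivAt (fun t ↦ ‖v t‖ ^ 2) (2 * inner ℝ (v t) (g t - v t)) t := (hv t).norm_sq

lemma two_mul_inner_sub_le {x y : E} {q ε : ℝ} (h : ‖y‖ ≤ q * ‖x‖ + ε) :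
    2 * inner ℝ x (y - x) ≤ 2 * (q - 1) * ‖x‖ ^ 2 + 2 * (ε * ‖x‖) := by
  rw [inner_sub_right, real_inner_self_eq_norm_sq]
  have h1 := real_inner_le_norm x y
  have h2 := mul_le_mul_of_nonneg_left h (norm_nonneg x)
  nlinarith

/-- The ball of radius `M` is invariant, because `2 ⟪v, g - v⟫ ≤ M² - ‖v‖²`. -/
lemma norm_le_of_relaxation {M : ℝ} (hv : ∀ t, HasDerivAt v (g t - v t) t) (h0 : ‖v 0‖ ≤ M)
    (hg : ∀ t, ‖g t‖ ≤ M) {t : ℝ} (ht : 0 ≤ t) : ‖v t‖ ≤ M := by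
  have hM : 0 ≤ M := (norm_nonneg _).trans h0
  have h := le_exp_mul_of_deriv_le (K := -1) (e := M ^ 2) ht (by norm_num)
    (hasDerivAt_norm_sq_relaxation hv) (fun s _ ↦ by
      have := two_mul_inner_sub_le (x := v s) (y := g s) (q := 0) (ε := M) (by simpa using hg s)
      nlinarith [sq_nonneg (‖v s‖ - M)])
  have h1 : ‖v 0‖ ^ 2 ≤ M ^ 2 := by gcongr
  have h2 : Real.exp (-1 * (t - 0)) * (‖v 0‖ ^ 2 + M ^ 2 / -1) ≤ 0 :=
    mul_nonpos_of_nonneg_of_nonpos (Real.exp_pos _).le (by linarith)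
  exact le_of_sq_le_sq (by linarith) hM

/-- Growth on `[0, T]` followed by exponential relaxation after `T`. -/
lemma norm_sq_le_of_relaxation {T t c ε : ℝ} (hv : ∀ t, HasDerivAt v (g t - v t) t) (hT : 0 ≤ T)
    (hTt : T ≤ t) (hT8 : Real.exp (6 * T) ≤ 8) (hc : 0 < c)
    (h3 : ∀ s, 0 < s → ‖g s‖ ≤ 3 * ‖v s‖ + ε) (hcontr : ∀ s, T < s → ‖g s‖ ≤ (1 - c) * ‖v s‖ + ε) :
    ‖v t‖ ^ 2 ≤ 8 * Real.exp (-c * (t - T)) * ‖v 0‖ ^ 2 + ε ^ 2 * (1 + (c ^ 2)⁻¹) := by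
  have hp := hasDerivAt_norm_sq_relaxation hv
  -- `6 = 2 (3 - 1) + 2`, where the last `2` comes from `2 ε ‖v‖ ≤ 2 ‖v‖² + ε² / 2`.
  have hA := le_exp_mul_of_deriv_le (K := 6) (e := ε ^ 2 / 2) hT (by norm_num) hp (fun s hs ↦ by
      have := two_mul_inner_sub_le (h3 s hs.1)
      nlinarith [sq_nonneg (2 * ‖v s‖ - ε)])
  -- The squared norm contracts at rate `2 c`; half of this is spent on `2 ε ‖v‖ ≤ c ‖v‖² + ε² / c`.
  have hB := le_exp_mul_of_deriv_le (K := -c) (e := ε ^ 2 / c) hTt (by linarith) hp (fun s hs ↦ by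
      have h1 := two_mul_inner_sub_le (hcontr s hs.1)
      have h2 : 0 ≤ (c * ‖v s‖ - ε) ^ 2 / c := by positivity
      have h3 : (c * ‖v s‖ - ε) ^ 2 / c = c * ‖v s‖ ^ 2 - 2 * (ε * ‖v s‖) + ε ^ 2 / c := by
        field_simp
        ring
      linarith)
  have e : ε ^ 2 / c / -c = -(ε ^ 2 * (c ^ 2)⁻¹) := by field_simp
  rw [e] at hB
  have hpos : 0 ≤ ε ^ 2 * (c ^ 2)⁻¹ := by positivity
  set y := Real.exp (-c * (t - T))
  have hy0 : 0 < y := Real.exp_pos _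
  have hy1 : y ≤ 1 := Real.exp_le_one_iff.2 (by nlinarith)
  rw [sub_zero] at hA
  have hvT : ‖v T‖ ^ 2 ≤ 8 * ‖v 0‖ ^ 2 + ε ^ 2 := by
    have h1 : Real.exp (6 * T) * (‖v 0‖ ^ 2 + ε ^ 2 / 2 / 6) ≤ 8 * (‖v 0‖ ^ 2 + ε ^ 2 / 2 / 6) := by
      gcongr
    have := sq_nonneg ε
    linarith
  have h2 := mul_le_mul_of_nonneg_left hvT hy0.le
  have h3 : y * ε ^ 2 ≤ ε ^ 2 := mul_le_of_le_one_left (sq_nonneg _) hy1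
  have h4 : 0 ≤ y * (ε ^ 2 * (c ^ 2)⁻¹) := by positivity
  linarith

end Comparison

/-! ### The initial time -/

section InitialTime

variable {α γ σ₀ : ℝ}

lemma initialTime_nonneg : 0 ≤ initialTime α γ σ₀ := by
  unfold initialTime
  have : 0 ≤ Real.log (1 + max (1 - 2 * α * σ₀ ^ 2 / γ) 0) :=
    Real.log_nonneg (by linarith [le_max_right (1 - 2 * α * σ₀ ^ 2 / γ) 0])
  linarith

lemma exp_two_mul_initialTime :
    Real.exp (2 * initialTime α γ σ₀) = 1 + max (1 - 2 * α * σ₀ ^ 2 / γ) 0 := by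
  unfold initialTime
  rw [← mul_assoc, mul_one_div_cancel two_ne_zero, one_mul, Real.exp_log]
  linarith [le_max_right (1 - 2 * α * σ₀ ^ 2 / γ) 0]

lemma exp_six_mul_initialTime_le (hα : 0 < α) (hγ : 0 < γ) :
    Real.exp (6 * initialTime α γ σ₀) ≤ 8 := by
  have e : 6 * initialTime α γ σ₀ = (3 : ℕ) * (2 * initialTime α γ σ₀) := by push_cast; ring
  rw [e, Real.exp_nat_mul, exp_two_mul_initialTime]
  have h0 : 0 ≤ 2 * α * σ₀ ^ 2 / γ := by positivity
  have h1 : max (1 - 2 * α * σ₀ ^ 2 / γ) 0 ≤ 1 := max_le (by linarith) zero_le_one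
  have h2 := le_max_right (1 - 2 * α * σ₀ ^ 2 / γ) 0
  calc _ ≤ (2 : ℝ) ^ 3 := by gcongr; linarith
    _ = 8 := by norm_num

/-- The claim is `α S t ≥ γ / 2`. With `q = 2 α σ₀² / γ` this reads `exp (-2 t) (2 - q) ≤ 1`, which
holds since `exp (2 T) = 1 + (1 - q)⁺ ≥ 2 - q`. -/
lemma inv_mul_variance_le (hα : 0 < α) (hγ : 0 < γ) {t : ℝ} (ht : initialTime α γ σ₀ ≤ t) :
    (α * (Real.exp (-2 * t) * σ₀ ^ 2 + γ / α * (1 - Real.exp (-2 * t))))⁻¹ ≤ 2 / γ := by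
  set y := Real.exp (-2 * t)
  have hy0 : 0 < y := Real.exp_pos _
  set q := 2 * α * σ₀ ^ 2 / γ
  have hμ : y * (1 + max (1 - q) 0) ≤ 1 := by
    have h := exp_two_mul_initialTime (α := α) (γ := γ) (σ₀ := σ₀)
    simp only [q]
    rw [← h, ← Real.exp_add, Real.exp_le_one_iff]
    linarith
  have h1 : y * (2 - q) ≤ 1 := by
    have := mul_le_mul_of_nonneg_left (le_max_left (1 - q) 0) hy0.le
    linarith
  have hq : 2 * α * σ₀ ^ 2 = q * γ := by simp only [q]; field_simp
  have e : α * (y * σ₀ ^ 2 + γ / α * (1 - y)) = γ / 2 * (2 - y * (2 - q)) := by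
    have : α * (y * σ₀ ^ 2 + γ / α * (1 - y)) = y * (2 * α * σ₀ ^ 2) / 2 + γ * (1 - y) := by
      field_simp
    rw [this, hq]
    ring
  rw [e, (inv_div γ 2).symm]
  refine inv_anti₀ (by positivity) ?_
  nlinarith

end InitialTime

/-! ### Growth of the gradient and the main theorem -/

lemma exists_fderiv_exp_growth {d : ℕ} {f : EuclideanSpace ℝ (Fin d) → ℝ}
    (xs : EuclideanSpace ℝ (Fin d))
    (hgrad : ∃ a L : ℝ, 0 < a ∧ 0 < L ∧ ∀ x, ‖gradient f x‖ ≤ L * (1 + ‖x‖ ^ a)) {c : ℝ}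
    (hc : 0 < c) : ∃ A : ℝ, 0 ≤ A ∧ ∀ x, ‖fderiv ℝ f x‖ ≤ A * Real.exp (c * ‖x - xs‖) := by
  obtain ⟨a, L, ha, hL, h⟩ := hgrad
  obtain ⟨A, hA, hexp⟩ := exists_one_add_rpow_le_exp a hc
  refine ⟨2 * L * A * Real.exp (c * ‖xs‖), by positivity, fun x ↦ ?_⟩
  have hn : ‖fderiv ℝ f x‖ = ‖gradient f x‖ := by
    rw [gradient, LinearIsometryEquiv.norm_map]
  have h1 : (1 : ℝ) ≤ (1 + ‖x‖) ^ a := Real.one_le_rpow (by linarith [norm_nonneg x]) ha.le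
  have h2 : ‖x‖ ^ a ≤ (1 + ‖x‖) ^ a :=
    Real.rpow_le_rpow (norm_nonneg _) (by linarith) ha.le
  have h3 : ‖x‖ ≤ ‖x - xs‖ + ‖xs‖ := by simpa using norm_add_le (x - xs) xs
  calc _ ≤ L * (1 + ‖x‖ ^ a) := hn ▸ h x
    _ ≤ L * (2 * (A * Real.exp (c * ‖x‖))) := by
      gcongr
      linarith [hexp ‖x‖ (norm_nonneg _)]
    _ ≤ L * (2 * (A * Real.exp (c * (‖x - xs‖ + ‖xs‖)))) := by gcongr
    _ = _ := by rw [mul_add, Real.exp_add]; ring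

theorem theorem1 {d : ℕ} (f : EuclideanSpace ℝ (Fin d) → ℝ) (xs : EuclideanSpace ℝ (Fin d))
    (κ β δ lam : ℝ) (hκ : 0 < κ) (hβ : 1 ≤ β) (hδ : 0 < δ) (hlam : 0 < lam)
    (hf : ContDiff ℝ 3 f)
    (hgrad : ∃ a L : ℝ, 0 < a ∧ 0 < L ∧ ∀ x, ‖gradient f x‖ ≤ L * (1 + ‖x‖ ^ a))
    (hmin : ∀ x, x ≠ xs → f xs < f x)
    (hgrowth : ∀ x, f xs + κ / 2 * ‖x - xs‖ ^ β ≤ f x)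
    (hconv : StrongConvexOn (Metric.ball xs δ) lam f)
    (γ : ℝ) (hγ : 0 < γ) :
    ∃ α₀ : ℝ, 0 < α₀ ∧
      ∀ (R : ℝ) (m₀ : EuclideanSpace ℝ (Fin d)) (σ₀ : ℝ),
        ‖xs‖ + δ ≤ R → 0 ≤ σ₀ →
        8 * max R ‖m₀ - xs‖ / (κ * δ ^ (β - 1)) < γ →
        ∀ α : ℝ, α₀ < α →
        ∀ (Ω : Type*) [MeasurableSpace Ω] (P : Measure Ω) [IsProbabilityMeasure P]
          (B X : ℝ≥0 → Ω → EuclideanSpace ℝ (Fin d)),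
          IsClippedSolution P f α γ R
            (multivariateGaussian m₀ (σ₀ ^ 2 • (1 : Matrix (Fin d) (Fin d) ℝ))) B X →
          ∀ t : ℝ≥0, initialTime α γ σ₀ < t →
            Integrable (fun ω ↦ ‖X t ω - xs‖ ^ 2) P ∧
            ∫ ω, ‖X t ω - xs‖ ^ 2 ∂P ≤
              6 * γ * d / α
                + 9 * Real.exp (-(1 + 2 / (γ * lam))⁻¹ * (t - initialTime α γ σ₀))
                  * ∫ ω, ‖X 0 ω - xs‖ ^ 2 ∂P := by
  have hmin' : ∀ x, f xs ≤ f x := fun x ↦ by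
    rcases eq_or_ne x xs with rfl | hx
    · exact le_rfl
    · exact (hmin x hx).le
  obtain ⟨C, α₁, hC, hα₁, hmean⟩ := exists_mean_bounds hf
    (fun c hc ↦ exists_fderiv_exp_growth xs hgrad hc) hκ hβ hδ hlam hγ hmin' hgrowth hconv
  set c₁ : ℝ := (1 + 2 / (γ * lam))⁻¹
  have hc₁ : 0 < c₁ := by positivity
  have hc₁1 : c₁ ≤ 1 := inv_le_one_of_one_le₀ (by
    have : 0 ≤ 2 / (γ * lam) := by positivity
    linarith)
  have hgr : ∀ x, f xs + κ / 2 * (‖x - xs‖ - 1) ≤ f x := fun x ↦ by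
    refine le_trans ?_ (hgrowth x)
    gcongr
    rcases le_total ‖x - xs‖ 1 with h | h
    · have : 0 ≤ ‖x - xs‖ ^ β := by positivity
      linarith
    · have := Real.self_le_rpow_of_one_le h hβ
      linarith
  -- The second summand makes the squared error `C² (1 + c₁⁻²) / α²` at most `5 γ / α`, hence at
  -- most `5 γ d / α` if `d ≥ 1`; the sixth `γ d / α` is the stationary variance. For `d = 0` the
  -- space is a single point.
  refine ⟨α₁ + C ^ 2 * (1 + (c₁ ^ 2)⁻¹) / (5 * γ), by positivity,
    fun R m₀ σ₀ hR hσ₀ hγ₀ α hα Ω _ P _ B X hsol t ht ↦ ?_⟩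
  have hK : 0 < κ * δ ^ (β - 1) := by positivity
  have hαα₁ : α₁ ≤ α := by
    have : 0 ≤ C ^ 2 * (1 + (c₁ ^ 2)⁻¹) / (5 * γ) := by positivity
    linarith
  have hα0 : 0 < α := by linarith
  have hxsR : ‖xs‖ ≤ R := by linarith
  have hR0 : 0 < R := by linarith [norm_nonneg xs]
  obtain ⟨hc, hlaw⟩ := hsol.map_eq hκ hα0 hγ hR0 (sq_nonneg σ₀) hf.continuous hgr
  set c : ℝ → EuclideanSpace ℝ (Fin d) :=
    fun s : ℝ ↦ clip R (consensusPoint f α (P.map (X s.toNNReal)))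
  set m : ℝ → EuclideanSpace ℝ (Fin d) := relaxationPath m₀ c
  set S : ℝ → ℝ := fun t ↦ Real.exp (-2 * t) * σ₀ ^ 2 + γ / α * (1 - Real.exp (-2 * t))
  have hSnn : ∀ t, 0 ≤ t → 0 ≤ S t := fun t ht ↦ by
    have : Real.exp (-2 * t) ≤ 1 := Real.exp_le_one_iff.2 (by linarith)
    have : 0 ≤ 1 - Real.exp (-2 * t) := by linarith
    positivity
  have hSpos : ∀ t, 0 < t → 0 < S t := fun t ht ↦ by
    have : Real.exp (-2 * t) < 1 := Real.exp_lt_one_iff.2 (by linarith)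
    have : 0 < 1 - Real.exp (-2 * t) := by linarith
    positivity
  have hmom : ∀ t : ℝ≥0, Integrable (fun ω ↦ ‖X t ω - xs‖ ^ 2) P ∧
      ∫ ω, ‖X t ω - xs‖ ^ 2 ∂P = ‖m t - xs‖ ^ 2 + d * S t := fun t ↦ by
    have h := secondMoment_isotropicGaussian (m t) xs (hSnn t t.coe_nonneg)
    rw [← hlaw t] at h
    have hcont : Continuous fun x : EuclideanSpace ℝ (Fin d) ↦ ‖x - xs‖ ^ 2 := by fun_prop
    rw [integrable_map_measure hcont.aestronglyMeasurable (hsol.measurable t).aemeasurable,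
      integral_map (hsol.measurable t).aemeasurable hcont.aestronglyMeasurable] at h
    exact h
  have hv : ∀ s, HasDerivAt (fun s ↦ m s - xs) ((c s - xs) - (m s - xs)) s := fun s ↦
    ((hasDerivAt_relaxationPath m₀ hc s).sub_const xs).congr_deriv (by simp [m])
  have hm0 : m 0 = m₀ := by simp [m, relaxationPath]
  -- Here `γ > γ₀` is used. Both `m₀ - xs` and `c s - xs` have norm at most `2 max R ‖m₀ - xs‖`, so
  -- this ball is invariant for the mean, and `8 max R ‖m₀ - xs‖ < γ κ δ ^ (β - 1)`.
  have hbound : ∀ s, 0 ≤ s → ‖m s - xs‖ ≤ γ * (κ * δ ^ (β - 1)) / 4 := by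
    intro s hs
    rw [div_lt_iff₀ hK] at hγ₀
    have hM : 2 * max R ‖m₀ - xs‖ ≤ γ * (κ * δ ^ (β - 1)) / 4 := by linarith
    refine (norm_le_of_relaxation (M := 2 * max R ‖m₀ - xs‖) hv ?_ (fun s ↦ ?_) hs).trans hM
    · rw [hm0]
      linarith [le_max_right R ‖m₀ - xs‖, norm_nonneg (m₀ - xs)]
    · have h1 := norm_sub_le (c s) xs
      have h2 : ‖c s‖ ≤ R := norm_clip_le hR0 _
      linarith [le_max_left R ‖m₀ - xs‖]
  have hcθ : ∀ s, 0 < s → ‖c s - xs‖ ≤ ‖∫ x, x ∂(gibbs f α (α * S s)⁻¹ (m s)) - xs‖ := by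
    intro s hs
    refine (norm_clip_sub_le hR0 _ hxsR).trans_eq ?_
    rw [hlaw, Real.coe_toNNReal s hs.le]
    exact congrArg (‖· - xs‖) (consensusPoint_isotropicGaussian hα0 (hSpos s hs) (m s))
  set T := initialTime α γ σ₀
  have hT0 : 0 ≤ T := initialTime_nonneg
  have h3 : ∀ s, 0 < s → ‖c s - xs‖ ≤ 3 * ‖m s - xs‖ + C / α := fun s hs ↦
    (hcθ s hs).trans (hmean α _ (m s) hαα₁ (by have := hSpos s hs; positivity)
      (hbound s hs.le)).2
  have hcontr : ∀ s, T < s → ‖c s - xs‖ ≤ (1 - c₁) * ‖m s - xs‖ + C / α :=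
    fun s hTs ↦ by
      have hs : 0 < s := hT0.trans_lt hTs
      have := hSpos s hs
      exact (hcθ s hs).trans ((hmean α _ (m s) hαα₁ (by positivity) (hbound s hs.le)).1
        (inv_mul_variance_le hα0 hγ hTs.le))
  have hmain := norm_sq_le_of_relaxation (ε := C / α) hv hT0 ht.le
    (exp_six_mul_initialTime_le hα0 hγ) hc₁ h3 hcontr
  rw [hm0] at hmain
  refine ⟨(hmom t).1, ?_⟩
  rw [(hmom t).2, (hmom 0).2]
  simp only [NNReal.coe_zero, hm0]
  have hS0 : S 0 = σ₀ ^ 2 := by simp [S]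
  rw [hS0]
  set y := Real.exp (-c₁ * (t - T))
  have hy : 0 < y := Real.exp_pos _
  have ht0 : (0 : ℝ) ≤ t := t.coe_nonneg
  -- Since `c₁ ≤ 1` and `T ≥ 0`, the initial variance decays at least as fast as `y`; it is absorbed
  -- by the factor `9` in front of the initial second moment.
  have hSt : S t ≤ y * σ₀ ^ 2 + γ / α := by
    have h1 : Real.exp (-2 * (t : ℝ)) ≤ y := Real.exp_le_exp.2 (by nlinarith)
    have h2 := mul_le_mul_of_nonneg_right h1 (sq_nonneg σ₀)
    have h4 : 0 ≤ γ / α * Real.exp (-2 * (t : ℝ)) := by positivity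
    simp only [S]
    linarith
  have hdS := mul_le_mul_of_nonneg_left hSt (Nat.cast_nonneg (α := ℝ) d)
  have hnoise : 0 ≤ y * (d * σ₀ ^ 2) := by positivity
  have hinit : 0 ≤ y * ‖m₀ - xs‖ ^ 2 := by positivity
  have hγd : 6 * γ * d / α = 5 * γ * d / α + d * (γ / α) := by ring
  have hmt : ‖m t - xs‖ ^ 2 ≤ 8 * y * ‖m₀ - xs‖ ^ 2 + 5 * γ * d / α := by
    rcases Nat.eq_zero_or_pos d with rfl | hd
    · rw [Subsingleton.elim (m t) xs, Subsingleton.elim m₀ xs]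
      simp
    · have hd1 : (1 : ℝ) ≤ d := by exact_mod_cast hd
      have h1 : C ^ 2 * (1 + (c₁ ^ 2)⁻¹) ≤ 5 * γ * α := by
        have h2 : C ^ 2 * (1 + (c₁ ^ 2)⁻¹) / (5 * γ) ≤ α := by linarith
        rw [div_le_iff₀ (by positivity)] at h2
        linarith
      have h2 : (C / α) ^ 2 * (1 + (c₁ ^ 2)⁻¹) ≤ 5 * γ * d / α := by
        calc (C / α) ^ 2 * (1 + (c₁ ^ 2)⁻¹) = C ^ 2 * (1 + (c₁ ^ 2)⁻¹) / α ^ 2 := by ring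
          _ ≤ 5 * γ * α / α ^ 2 := by gcongr
          _ = 5 * γ * 1 / α := by field_simp
          _ ≤ 5 * γ * d / α := by gcongr
      linarith
  rw [hγd]
  linarith
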